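/- **Setting.** A *local Moufang set* $\mathbb M$ consists of a set with equivalence relation $(X,\sim)$ having more than two classes and, for each $x\in X$, a group $U_x$ of $\sim$-preserving permutations of $X$ (acting on the right), such that, with $G=\langle U_x\mid x\in X\rangle$, $[x]$ the class of $x$ and $\overline{U_x}$ the group induced by $U_x$ on the set $\overline X$ of classes: $\overline{U_x}=\overline{U_y}$ whenever $x\sim y$; $U_x$ fixes $x$ and acts sharply transitively on $X\setminus[x]$; $\overline{U_x}$ fixes $[x]$ and acts sharply transitively on $\overline X\setminus\{[x]\}$; and $g^{-1}U_xg=U_{xg}$ for all $x\in X$, $g\in G$. Fix $0,\infty\in X$ with $0\nsim\infty$. A *unit* is an $x\in X$ with $x\nsim0$ and $x\nsim\infty$. For $x\nsim\infty$ let $\alpha_x$ be the unique element of $U_\infty$ with $0\alpha_x=x$, and put $-x=0\alpha_x^{-1}$ and $x\cdot k=0\alpha_x^k$ for $k\ge1$. For a unit $x$ let $\mu_x$ be the unique element of $U_0\alpha_xU_0$ that interchanges $0$ and $\infty$. Fix a unit $e$ and let $\tau=\mu_e$. Assume: * (J1) $\mathbb M$ is special: $(-(x\tau^{-1}))\tau=-x$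 for all units $x$; * (J2) $U_\infty$ is abelian (hence so is $U_0$); * (J3) if $x$ is a unit, then so are $x\cdot2$ and $x\cdot3$. Let $V^+=X\setminus[\infty]$, an abelian group under $x+z=0\alpha_x\alpha_z$, and $V^-=X\setminus[0]$, an abelian group under $y\mathbin{\tilde+}w=\infty\beta_y\beta_w$, where $\beta_y$ is the unique element of $U_0$ with $\infty\beta_y=y$. Every $\mu_t$ maps $V^+$ to $V^-$ and $V^-$ to $V^+$. Assume moreover: * (J4) there are biadditive maps $\mu_{\cdot,\cdot}\colon V^+\times V^+\to\operatorname{Hom}(V^-,V^+)$ and $\tilde\mu_{\cdot,\cdot}\colon V^-\times V^-\to\operatorname{Hom}(V^+,V^-)$ such that $\mu_{x,z}=\mu_{x+z}-\mu_x-\mu_z$ whenever $x$, $z$ and $x+z$ are units, and $\tilde\mu_{y,w}=\mu_{y\tilde+w}\mathbin{\tilde-}\mu_y\mathbin{\tilde-}\mu_w$ whenever $y$, $w$ and $y\mathbin{\tilde+}w$ are units. **Jordan pairs.** Let $V=(V^+,V^-)$ be a pair of $k$-modules with quadratic maps $Q\colon V^\sigma\to\operatorname{Hom}(V^{-\sigma},V^\sigma)$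 ($\sigma=\pm$), and write $\{xyz\}=yQ_{x,z}=y(Q_{x+z}-Q_x-Q_z)$. Then $V$ is a *Jordan pair* over $k$ if, for both signs and in all scalar extensions of $k$, $\{x\,y\,zQ_x\}=\{y\,x\,z\}Q_x$, $\{yQ_x\,y\,z\}=\{x\,xQ_y\,z\}$ and $Q_{yQ_x}=Q_xQ_yQ_x$. An element $x$ is *invertible* if $Q_x$ is. An *ideal* is a pair of submodules $(I^+,I^-)$ with $xQ_y\in I^{-\sigma}$, $yQ_x\in I^\sigma$ and $\{xyz\}\in I^\sigma$ for $x\in I^\sigma$, $y\in V^{-\sigma}$, $z\in V^\sigma$. A Jordan pair is *local* if its non-invertible elements form a proper ideal. For $x\in V^+$ and $y\in V^-$, $(x,y)$ is *quasi-invertible* if $z\mapsto z-\{xyz\}+zQ_yQ_x$ is an invertible map on $V^+$; $\operatorname{Rad}V=(\operatorname{Rad}V^+,\operatorname{Rad}V^-)$ consists of the $x\in V^+$ such that $(x,y)$ is quasi-invertible for all $y\in V^-$, and the $y\in V^-$ such that $(x,y)$ is quasi-invertible for all $x\in V^+$. **Theorem.** Under (J1)–(J4), $V^+$ is uniquely $2$-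 and $3$-divisible, $V^-$ is uniquely $2$-divisible, and $V=(V^+,V^-)$ with $$Q_x=\tfrac12\,\mu_{x,x}\ (x\in V^+),\qquad Q_y=\tfrac12\,\tilde\mu_{y,y}\ (y\in V^-)$$ is a Jordan pair over $\mathbb Z$. Its non-invertible elements form the proper ideal $([0],[\infty])$, so $V$ is a local Jordan pair, and $\operatorname{Rad}V=([0],[\infty])$. -/

import Mathlib

open scoped TensorProduct

universe t u v w

/-! ## Local Moufang sets

Permutations are written as functions, so the right-action product `g h` ("first `g`, then `h`") is
`h * g` here, the image `x g` is `g • x`, and the conjugate `u ^ g = g⁻¹ u g` is `g * u * g⁻¹`. -/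

/-- The group `Sym(X, ∼)` of equivalence-preserving bijections of `X`. -/
def SymRel {X : Type u} (r : Setoid X) : Subgroup (Equiv.Perm X) where
  carrier := {g | ∀ x y, r x y ↔ r (g x) (g y)}
  mul_mem' := by
    intro a b ha hb x y
    exact (hb x y).trans (ha (b x) (b y))
  one_mem' := fun _ _ => Iff.rfl
  inv_mem' := by
    intro a ha x y
    simpa using (ha (a⁻¹ x) (a⁻¹ y)).symm

/-- The permutation of the set of classes induced by an element of `Sym(X, ∼)`. -/
def SymRel.induced {X : Type u} (r : Setoid X) : SymRel r →* Equiv.Perm (Quotient r) where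
  toFun g := Quotient.congr (g : Equiv.Perm X) g.2
  map_one' := by
    ext q
    induction q using Quotient.inductionOn
    rfl
  map_mul' a b := by
    ext q
    induction q using Quotient.inductionOn
    rfl

theorem SymRel.rel_smul {X : Type u} {r : Setoid X} (g : SymRel r) (x y : X) :
    r (g • x) (g • y) ↔ r x y := (g.2 x y).symm

/-- A local Moufang set acting on `X`: an equivalence relation with more than two classes and a
root group `U x` for each point `x`. Sharp transitivity is required of the action of `U x` on
`X ∖ [x]` and of the induced group on the set of classes other than `[x]`. -/
structure LocalMoufangSet (X : Type u) where
  /-- the equivalence relation `∼` -/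
  rel : Setoid X
  two_lt_card : 2 < Cardinal.mk (Quotient rel)
  /-- the root groups -/
  U : X → Subgroup (SymRel rel)
  induced_eq : ∀ x y, rel x y →
    (U x).map (SymRel.induced rel) = (U y).map (SymRel.induced rel)
  fixes : ∀ x, ∀ g ∈ U x, g • x = x
  sharplyTransitive : ∀ x y z, ¬ rel y x → ¬ rel z x → ∃! g, g ∈ U x ∧ g • y = z
  induced_fixes : ∀ x, ∀ g ∈ (U x).map (SymRel.induced rel),
    g • (Quotient.mk rel x) = Quotient.mk rel x
  induced_sharplyTransitive : ∀ x, ∀ y z : Quotient rel,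
    y ≠ Quotient.mk rel x → z ≠ Quotient.mk rel x →
      ∃! g, g ∈ (U x).map (SymRel.induced rel) ∧ g • y = z
  /-- `U_x ^ g = U_{x g}` for all `g` in the little projective group -/
  conj_eq : ∀ x, ∀ g ∈ (⨆ y, U y : Subgroup (SymRel rel)),
    (U x).map (MulAut.conj g).toMonoidHom = U (g • x)

namespace LocalMoufangSet

variable {X : Type u}

/-- A basis: a pair of non-equivalent points `(0, ∞)`. -/
structure Basis (M : LocalMoufangSet X) where
  zero : X
  inf : X
  not_rel : ¬ M.rel zero inf

namespace Basis

variable {M : LocalMoufangSet X}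

/-- The basis `(∞, 0)`. -/
def swap (B : M.Basis) : M.Basis := ⟨B.inf, B.zero, fun h => B.not_rel (M.rel.symm h)⟩

/-- `x` is a unit if `x ≁ 0` and `x ≁ ∞`. -/
def IsUnit (B : M.Basis) (x : X) : Prop := ¬ M.rel x B.zero ∧ ¬ M.rel x B.inf

/-- The set `X ∖ [∞]`. For the basis `B.swap` this is `X ∖ [0]`. -/
def Aff (B : M.Basis) : Type u := {x : X // ¬ M.rel x B.inf}

/-- `α_x`, the unique element of `U_∞` mapping `0` to `x`. For the basis `B.swap` this is the unique
element of `U_0` mapping `∞` to `x`. -/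
noncomputable def alpha (B : M.Basis) (x : B.Aff) : SymRel M.rel :=
  (M.sharplyTransitive B.inf B.zero x.1 B.not_rel x.2).choose

theorem alpha_mem (B : M.Basis) (x : B.Aff) : B.alpha x ∈ M.U B.inf :=
  (M.sharplyTransitive B.inf B.zero x.1 B.not_rel x.2).choose_spec.1.1

theorem alpha_smul (B : M.Basis) (x : B.Aff) : B.alpha x • B.zero = x.1 :=
  (M.sharplyTransitive B.inf B.zero x.1 B.not_rel x.2).choose_spec.1.2

theorem alpha_unique (B : M.Basis) (x : B.Aff) (g : SymRel M.rel) (hg : g ∈ M.U B.inf)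
    (h : g • B.zero = x.1) : g = B.alpha x :=
  (M.sharplyTransitive B.inf B.zero x.1 B.not_rel x.2).choose_spec.2 g ⟨hg, h⟩

theorem smul_not_rel (B : M.Basis) (g : SymRel M.rel) (hg : g ∈ M.U B.inf) (x : X)
    (hx : ¬ M.rel x B.inf) : ¬ M.rel (g • x) B.inf := by
  rw [← M.fixes B.inf g hg]
  rwa [SymRel.rel_smul]

/-- The point `0 g` of `X ∖ [∞]`, for `g ∈ U_∞`. -/
def orbitPt (B : M.Basis) (g : SymRel M.rel) (hg : g ∈ M.U B.inf) : B.Aff :=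
  ⟨g • B.zero, B.smul_not_rel g hg B.zero B.not_rel⟩

theorem alpha_orbitPt (B : M.Basis) (g : SymRel M.rel) (hg : g ∈ M.U B.inf) :
    B.alpha (B.orbitPt g hg) = g :=
  (B.alpha_unique _ g hg rfl).symm

theorem orbitPt_alpha (B : M.Basis) (x : B.Aff) :
    B.orbitPt (B.alpha x) (B.alpha_mem x) = x := Subtype.ext (B.alpha_smul x)

theorem alpha_injective (B : M.Basis) : Function.Injective B.alpha := by
  intro x y h
  apply Subtype.ext
  rw [← B.alpha_smul x, ← B.alpha_smul y, h]

/-- `-x = 0 α_x⁻¹`. -/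
noncomputable def neg (B : M.Basis) (x : B.Aff) : B.Aff :=
  B.orbitPt (B.alpha x)⁻¹ (inv_mem (B.alpha_mem x))

/-- `x + z = 0 α_x α_z`. -/
noncomputable def add (B : M.Basis) (x z : B.Aff) : B.Aff :=
  B.orbitPt (B.alpha z * B.alpha x) (mul_mem (B.alpha_mem z) (B.alpha_mem x))

/-- `x · k = 0 α_x ^ k`. -/
noncomputable def times (B : M.Basis) (x : B.Aff) (k : ℕ) : B.Aff :=
  B.orbitPt (B.alpha x ^ k) (pow_mem (B.alpha_mem x) k)

theorem neg_not_rel (B : M.Basis) (x : B.Aff) (hx : ¬ M.rel x.1 B.zero) :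
    ¬ M.rel (B.neg x).1 B.zero := by
  intro h
  apply hx
  have h1 := (SymRel.rel_smul (B.alpha x) _ _).2 h
  have h2 : B.alpha x • (B.neg x).1 = B.zero := by
    change B.alpha x • ((B.alpha x)⁻¹ • B.zero) = B.zero
    rw [smul_inv_smul]
  rw [h2, B.alpha_smul] at h1
  exact M.rel.symm h1

/-- The element `α_x` for a unit `x`. -/
noncomputable def alphaUnit (B : M.Basis) (x : X) (hx : B.IsUnit x) : SymRel M.rel :=
  B.alpha ⟨x, hx.2⟩

/-- For each unit `x` there is a unique element of `U_0 α_x U_0` that swaps `0` and `∞`. -/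
theorem existsUnique_mu (B : M.Basis) (x : X) (hx : B.IsUnit x) :
    ∃! m : SymRel M.rel,
      (∃ g ∈ M.U B.zero, ∃ h ∈ M.U B.zero, m = h * B.alphaUnit x hx * g) ∧
        m • B.zero = B.inf ∧ m • B.inf = B.zero := by
  have hi : ¬ M.rel B.inf B.zero := fun h => B.not_rel (M.rel.symm h)
  have hn := B.neg_not_rel ⟨x, hx.2⟩ hx.1
  have ha : B.alphaUnit x hx • B.zero = x := B.alpha_smul ⟨x, hx.2⟩
  have hneg : B.alphaUnit x hx • (B.neg ⟨x, hx.2⟩).1 = B.zero := by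
    change B.alpha _ • ((B.alpha _)⁻¹ • B.zero) = B.zero
    rw [smul_inv_smul]
  obtain ⟨g, ⟨hg, hg2⟩, hgu⟩ := M.sharplyTransitive B.zero B.inf _ hi hn
  obtain ⟨h, ⟨hh, hh2⟩, hhu⟩ := M.sharplyTransitive B.zero x B.inf hx.1 hi
  refine ⟨h * B.alphaUnit x hx * g, ⟨⟨g, hg, h, hh, rfl⟩, ?_, ?_⟩, ?_⟩
  · rw [mul_smul, mul_smul, M.fixes _ g hg, ha, hh2]
  · rw [mul_smul, mul_smul, hg2, hneg, M.fixes _ h hh]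
  · rintro m ⟨⟨g', hg', h', hh', rfl⟩, h1, h2⟩
    have e1 : h' = h := by
      apply hhu
      refine ⟨hh', ?_⟩
      rwa [mul_smul, mul_smul, M.fixes _ g' hg', ha] at h1
    have e2 : g' = g := by
      apply hgu
      refine ⟨hg', ?_⟩
      have h3 : B.alphaUnit x hx • g' • B.inf = B.zero := by
        apply MulAction.injective h'
        change h' • _ = h' • _
        rw [M.fixes _ h' hh', ← mul_smul, ← mul_smul]
        exact h2
      apply MulAction.injective (B.alphaUnit x hx)
      change B.alphaUnit x hx • _ = B.alphaUnit x hx • _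
      rw [h3, hneg]
    rw [e1, e2]

/-- The `μ`-map `μ_x` of a unit `x`. -/
noncomputable def mu (B : M.Basis) (x : X) (hx : B.IsUnit x) : SymRel M.rel :=
  (B.existsUnique_mu x hx).choose

theorem mu_zero (B : M.Basis) (x : X) (hx : B.IsUnit x) : B.mu x hx • B.zero = B.inf :=
  (B.existsUnique_mu x hx).choose_spec.1.2.1

theorem mu_inf (B : M.Basis) (x : X) (hx : B.IsUnit x) : B.mu x hx • B.inf = B.zero :=
  (B.existsUnique_mu x hx).choose_spec.1.2.2

/-- `μ_t` as a map from `X ∖ [0]` to `X ∖ [∞]`. -/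
noncomputable def muPlus (B : M.Basis) (t : X) (ht : B.IsUnit t) (y : B.swap.Aff) : B.Aff :=
  ⟨B.mu t ht • y.1, fun h => y.2 (by
    rw [← B.mu_zero t ht, SymRel.rel_smul] at h
    exact h)⟩

/-- `μ_t` as a map from `X ∖ [∞]` to `X ∖ [0]`. -/
noncomputable def muMinus (B : M.Basis) (t : X) (ht : B.IsUnit t) (x : B.Aff) : B.swap.Aff :=
  ⟨B.mu t ht • x.1, fun h => x.2 (by
    change M.rel _ B.zero at h
    rw [← B.mu_inf t ht, SymRel.rel_smul] at h
    exact h)⟩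

/-- `μ_t⁻¹` as a map from `X ∖ [0]` to `X ∖ [∞]`. -/
noncomputable def muInvPlus (B : M.Basis) (t : X) (ht : B.IsUnit t) (y : B.swap.Aff) : B.Aff :=
  ⟨(B.mu t ht)⁻¹ • y.1, fun h => y.2 (by
    rw [← SymRel.rel_smul (B.mu t ht), smul_inv_smul, B.mu_inf] at h
    exact h)⟩

/-- `~x = (-(x τ⁻¹)) τ`, where `τ = μ_e`. -/
noncomputable def til (B : M.Basis) (e : X) (he : B.IsUnit e) (x : X) (hx : B.IsUnit x) : X :=
  (B.muMinus e he (B.neg (B.muInvPlus e he ⟨x, hx.1⟩))).1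

/-- `M` is special (with respect to the basis `(0, ∞)` and `τ = μ_e`): `~x = -x` for all units. -/
def IsSpecial (B : M.Basis) (e : X) (he : B.IsUnit e) : Prop :=
  ∀ (x : X) (hx : B.IsUnit x), B.til e he x hx = (B.neg ⟨x, hx.2⟩).1

/-- The root group `U_∞` is abelian. -/
def IsAbelian (B : M.Basis) : Prop := ∀ g ∈ M.U B.inf, ∀ h ∈ M.U B.inf, g * h = h * g

theorem exists_unit (B : M.Basis) : ∃ c, B.IsUnit c := by
  have h3 : (3 : Cardinal) ≤ Cardinal.mk (Quotient M.rel) := by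
    have h := M.two_lt_card
    have h' := (Cardinal.natCast_add_one_le_iff (n := 2)).2 (by exact_mod_cast h)
    norm_num at h'
    exact h'
  obtain ⟨z, hz1, hz2⟩ := Cardinal.exists_ne_ne_of_three_le h3 (Quotient.mk M.rel B.zero) (Quotient.mk M.rel B.inf)
  induction z using Quotient.inductionOn with
  | h c => exact ⟨c, fun h => hz1 (Quotient.sound h), fun h => hz2 (Quotient.sound h)⟩

/-- If `U_∞` is abelian, then so is `U_0`. -/
theorem IsAbelian.swap {B : M.Basis} (hB : B.IsAbelian) : B.swap.IsAbelian := by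
  obtain ⟨c, hc0, hci⟩ := B.exists_unit
  obtain ⟨g, ⟨hg, hg2⟩, -⟩ := M.sharplyTransitive c B.inf B.zero
    (fun h => hci (M.rel.symm h)) (fun h => hc0 (M.rel.symm h))
  have hU := M.conj_eq B.inf g (Subgroup.mem_iSup_of_mem c hg)
  rw [hg2] at hU
  intro a ha b hb
  change a ∈ M.U B.zero at ha
  change b ∈ M.U B.zero at hb
  rw [← hU] at ha hb
  obtain ⟨a, ha, rfl⟩ := ha
  obtain ⟨b, hb, rfl⟩ := hb
  rw [← map_mul, ← map_mul, hB a ha b hb]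

/-- The `ℤ`-module `V⁺ = X ∖ [∞]`, with `x + z = 0 α_x α_z`, when `U_∞` is abelian. The `ℤ`-module
`V⁻ = X ∖ [0]` is the same construction for the basis `B.swap = (∞, 0)`. -/
def V (B : M.Basis) (_hB : B.IsAbelian) : Type u := B.Aff

noncomputable instance (B : M.Basis) (hB : B.IsAbelian) : Add (B.V hB) := ⟨fun x z => B.add x z⟩

noncomputable instance (B : M.Basis) (hB : B.IsAbelian) : Zero (B.V hB) :=
  ⟨B.orbitPt 1 (one_mem _)⟩

noncomputable instance (B : M.Basis) (hB : B.IsAbelian) : Neg (B.V hB) := ⟨fun x => B.neg x⟩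

noncomputable instance (B : M.Basis) (hB : B.IsAbelian) : AddCommGroup (B.V hB) where
  nsmul := nsmulRec
  zsmul := zsmulRec
  add_assoc x y z := by
    apply B.alpha_injective
    change B.alpha (B.add (B.add x y) z) = B.alpha (B.add x (B.add y z))
    simp only [add, alpha_orbitPt, mul_assoc]
  zero_add x := by
    apply B.alpha_injective
    change B.alpha (B.add (B.orbitPt 1 _) x) = B.alpha x
    simp only [add, alpha_orbitPt, mul_one]
  add_zero x := by
    apply B.alpha_injective
    change B.alpha (B.add x (B.orbitPt 1 _)) = B.alpha x
    simp only [add, alpha_orbitPt, one_mul]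
  neg_add_cancel x := by
    apply B.alpha_injective
    change B.alpha (B.add (B.neg x) x) = B.alpha (B.orbitPt 1 _)
    simp only [add, neg, alpha_orbitPt, mul_inv_cancel]
  add_comm x y := by
    apply B.alpha_injective
    change B.alpha (B.add x y) = B.alpha (B.add y x)
    simp only [add, alpha_orbitPt]
    exact hB _ (B.alpha_mem y) _ (B.alpha_mem x)

/-- The abelian group `V⁺`. -/
abbrev VPlus (B : M.Basis) (hB : B.IsAbelian) : Type u := B.V hB

/-- The abelian group `V⁻`. -/
abbrev VMinus (B : M.Basis) (hB : B.IsAbelian) : Type u := B.swap.V hB.swap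

/-- The underlying point of an element of `V⁺` (or of `V⁻`, for `B.swap`). -/
def V.pt {B : M.Basis} {hB : B.IsAbelian} (x : B.V hB) : X := Subtype.val x

/-- The bilinear map `b` extends `(x, z) ↦ μ_{x+z} - μ_x - μ_z : V⁻ → V⁺`, defined for units
`x`, `z` such that `x + z` is a unit. -/
def ExtendsMuPlus (B : M.Basis) (hB : B.IsAbelian)
    (b : B.VPlus hB →ₗ[ℤ] B.VPlus hB →ₗ[ℤ] B.VMinus hB →ₗ[ℤ] B.VPlus hB) : Prop :=
  ∀ (x z : B.VPlus hB) (hx : B.IsUnit x.pt) (hz : B.IsUnit z.pt) (hxz : B.IsUnit (x + z).pt)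
    (y : B.VMinus hB),
    b x z y = (show B.VPlus hB from B.muPlus (x + z).pt hxz y)
      - (show B.VPlus hB from B.muPlus x.pt hx y) - (show B.VPlus hB from B.muPlus z.pt hz y)

/-- The bilinear map `b` extends `(y, w) ↦ μ_{y+w} - μ_y - μ_w : V⁺ → V⁻`, defined for units
`y`, `w` such that `y + w` is a unit; the operations here are those of `V⁻`. -/
def ExtendsMuMinus (B : M.Basis) (hB : B.IsAbelian)
    (b : B.VMinus hB →ₗ[ℤ] B.VMinus hB →ₗ[ℤ] B.VPlus hB →ₗ[ℤ] B.VMinus hB) : Prop :=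
  ∀ (y w : B.VMinus hB) (hy : B.IsUnit y.pt) (hw : B.IsUnit w.pt) (hyw : B.IsUnit (y + w).pt)
    (x : B.VPlus hB),
    b y w x = (show B.VMinus hB from B.muMinus (y + w).pt hyw x)
      - (show B.VMinus hB from B.muMinus y.pt hy x) - (show B.VMinus hB from B.muMinus w.pt hw x)

end Basis

end LocalMoufangSet

/-! ## Jordan pairs

`Q x y` stands for `y Q_x`. -/

namespace JordanPair

section

variable {k : Type w} [CommRing k] {A : Type u} {B : Type v} [AddCommGroup A] [AddCommGroup B]
  [Module k A] [Module k B]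

/-- The triple product `{x y z} = y Q_{x,z} = y (Q_{x+z} - Q_x - Q_z)`. -/
def triple (Q : QuadraticMap k A (B →ₗ[k] A)) (x : A) (y : B) (z : A) : A :=
  (Q (x + z) - Q x - Q z) y

/-- The three Jordan pair identities for `x ∈ A = V^σ`, with `B = V^{-σ}`. -/
structure Identities (Q : QuadraticMap k A (B →ₗ[k] A)) (Q' : QuadraticMap k B (A →ₗ[k] B)) :
    Prop where
  jp1 : ∀ (x : A) (y z : B), triple Q x y (Q x z) = Q x (triple Q' y x z)
  jp2 : ∀ (x z : A) (y : B), triple Q (Q x y) y z = triple Q x (Q' y x) z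
  jp3 : ∀ (x : A) (y z : B), Q (Q x y) z = Q x (Q' y (Q x z))

/-- `Q'` is the scalar extension of `Q` to the commutative `k`-algebra `l`. -/
def IsScalarExtension {l : Type*} [CommRing l] [Algebra k l] (Q : QuadraticMap k A (B →ₗ[k] A))
    (Q' : QuadraticMap l (l ⊗[k] A) (l ⊗[k] B →ₗ[l] l ⊗[k] A)) : Prop :=
  ∀ (x : A) (y : B), Q' (1 ⊗ₜ[k] x) (1 ⊗ₜ[k] y) = 1 ⊗ₜ[k] Q x y

/-- The scalar extension of a quadratic map is unique. -/
theorem IsScalarExtension.unique {l : Type*} [CommRing l] [Algebra k l]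
    {Q : QuadraticMap k A (B →ₗ[k] A)}
    {Q₁ Q₂ : QuadraticMap l (l ⊗[k] A) (l ⊗[k] B →ₗ[l] l ⊗[k] A)}
    (h₁ : IsScalarExtension Q Q₁) (h₂ : IsScalarExtension Q Q₂) : Q₁ = Q₂ := by
  refine baseChange_ext (R := k) (A := l) (M₂ := A) (N₁ := l ⊗[k] B →ₗ[l] l ⊗[k] A) ?_
  intro x
  apply TensorProduct.AlgebraTensorModule.curry_injective
  ext y
  simpa using (h₁ x y).trans (h₂ x y).symm

/-- `(A, B)` with the quadratic maps `Qp`, `Qm` is a Jordan pair over `k`: the identities hold, for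
both signs, in all scalar extensions `l` of `k`. -/
def IsJordanPair (Qp : QuadraticMap k A (B →ₗ[k] A)) (Qm : QuadraticMap k B (A →ₗ[k] B)) :
    Prop :=
  Identities Qp Qm ∧ Identities Qm Qp ∧
  ∀ (l : Type t) [CommRing l] [Algebra k l],
    ∃ (Qp' : QuadraticMap l (l ⊗[k] A) (l ⊗[k] B →ₗ[l] l ⊗[k] A))
      (Qm' : QuadraticMap l (l ⊗[k] B) (l ⊗[k] A →ₗ[l] l ⊗[k] B)),
      IsScalarExtension Qp Qp' ∧ IsScalarExtension Qm Qm' ∧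
        Identities Qp' Qm' ∧ Identities Qm' Qp'

/-- `x` is invertible if `Q_x` is. -/
def IsInvertible (Q : QuadraticMap k A (B →ₗ[k] A)) (x : A) : Prop := Function.Bijective (Q x)

/-- The conditions on an ideal `(I, I')` for `x ∈ I ⊆ A`; an ideal satisfies them for both signs. -/
def IdealConditions (Q : QuadraticMap k A (B →ₗ[k] A)) (Q' : QuadraticMap k B (A →ₗ[k] B))
    (I : Submodule k A) (I' : Submodule k B) : Prop :=
  ∀ x ∈ I, ∀ (y : B) (z : A), Q' y x ∈ I' ∧ Q x y ∈ I ∧ triple Q x y z ∈ I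

/-- `(I, I')` is an ideal of the pair. -/
def IsIdeal (Qp : QuadraticMap k A (B →ₗ[k] A)) (Qm : QuadraticMap k B (A →ₗ[k] B))
    (I : Submodule k A) (I' : Submodule k B) : Prop :=
  IdealConditions Qp Qm I I' ∧ IdealConditions Qm Qp I' I

/-- The pair is local: the non-invertible elements form a proper ideal. -/
def IsLocal (Qp : QuadraticMap k A (B →ₗ[k] A)) (Qm : QuadraticMap k B (A →ₗ[k] B)) : Prop :=
  ∃ (I : Submodule k A) (I' : Submodule k B),
    (∀ x, x ∈ I ↔ ¬ IsInvertible Qp x) ∧ (∀ y, y ∈ I' ↔ ¬ IsInvertible Qm y) ∧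
      IsIdeal Qp Qm I I' ∧ ¬ (I = ⊤ ∧ I' = ⊤)

/-- The Bergman operator `B_{x,y} = id - D_{x,y} + Q_y Q_x` on `V⁺`, where `z D_{x,y} = {x y z}`. -/
def bergman (Qp : QuadraticMap k A (B →ₗ[k] A)) (Qm : QuadraticMap k B (A →ₗ[k] B))
    (x : A) (y : B) (z : A) : A :=
  z - triple Qp x y z + Qp x (Qm y z)

/-- `(x, y)` is quasi-invertible if `B_{x,y}` is invertible. -/
def IsQuasiInvertible (Qp : QuadraticMap k A (B →ₗ[k] A)) (Qm : QuadraticMap k B (A →ₗ[k] B))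
    (x : A) (y : B) : Prop :=
  Function.Bijective (bergman Qp Qm x y)

/-- The component in `V⁺` of the Jacobson radical. -/
def radPlus (Qp : QuadraticMap k A (B →ₗ[k] A)) (Qm : QuadraticMap k B (A →ₗ[k] B)) : Set A :=
  {x | ∀ y, IsQuasiInvertible Qp Qm x y}

/-- The component in `V⁻` of the Jacobson radical. -/
def radMinus (Qp : QuadraticMap k A (B →ₗ[k] A)) (Qm : QuadraticMap k B (A →ₗ[k] B)) : Set B :=
  {y | ∀ x, IsQuasiInvertible Qp Qm x y}

end

end JordanPair

/-- The abelian group `A` is uniquely `n`-divisible. -/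
def UniquelyDivisible (n : ℕ) (A : Type u) [AddCommGroup A] : Prop := ∀ a : A, ∃! b : A, n • b = a

/-!
Since `M` is special, the negatives of a unit `x` in `V⁺` and in `V⁻` agree. Hence
`μ_x = β_x⁻¹ α_x β_x⁻¹ = α_x β_x⁻¹ α_x`, and from these factorizations one reads off how `μ_x`
changes under negation, under conjugation by another `μ`-map, and under addition in `V⁺` or `V⁻`.

The biadditive extension of `μ_{x+z} - μ_x - μ_z`, evaluated at multiples of a unit `x`, gives
`μ_{4x} = 10 μ_x + 6 μ_{-x}` and `μ_{3x} = 6 μ_x + 3 μ_{-x}`. As `μ`-maps are invertible, `V⁺` and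
`V⁻` are uniquely divisible by `2` and `3`. Without `2`-torsion, a biadditive map is determined by
its values at units in general position, because the units are closed under multiplication by `2`
and `3` and the non-units form a subgroup. This yields `μ_{-x} = μ_x`, so that `Q_x = μ_x` for units
`x`, and it extends linearizations of identities from units to all elements.

The identities of the `Q_x` for units `x` express, up to sign, that `x`, viewed in the opposite
group, is the inverse of `x`. Their linearizations combine to the five-linear identity
`{x y {u v z}} - {u v {x y z}} = {{x y u} v z} - {u {y x v} z}`. In the absence of `3`-torsion it
implies the axioms of a Jordan pair, and being multilinear it survives scalar extension.

For the radical, let `B` be the Bergman operator of `(x, y)` and `B'` that of `(y, x)`. Then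
`Q_{z B} = B' Q_z B`. If `y` is a unit this holds because `B` is a product of two `Q`-operators; in
general the defect is a cubic polynomial in `y` along the direction of a unit, with four zeros. If
`x` or `y` is a non-unit, then `B` maps units to units, so `Q_{z B}` is invertible for a unit `z`,
and hence `B` is bijective.
-/

/-! ## Additive maps that vanish on units -/

section Units

/-- The complement of `N` (the set of "units") is nonempty and closed under multiplication by `2`
and by `3`. -/
structure UnitComplement {A σ : Type*} [AddCommGroup A] [SetLike σ A] (N : σ) : Prop where
  exists_notMem : ∃ x, x ∉ N
  two_nsmul : ∀ x, x ∉ N → 2 • x ∉ N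
  three_nsmul : ∀ x, x ∉ N → 3 • x ∉ N

/-- The elements `z`, `x + z` and `x - z` are units. An identity of odd or even degree that is known
for units can be linearized in the direction `z` at such a pair. -/
def InGeneralPosition {A σ : Type*} [AddCommGroup A] [SetLike σ A] (N : σ) (x z : A) : Prop :=
  z ∉ N ∧ x + z ∉ N ∧ x - z ∉ N

theorem exists_mem_of_not_inGeneralPosition {A σ : Type*} [AddCommGroup A]
    [SetLike σ A] {N : σ} {x z : A} (h : ¬ InGeneralPosition N x z) :
    ∃ n ∈ N, z = n ∨ z = n - x ∨ z = x - n := by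
  by_contra! hc
  exact h ⟨fun hz => (hc z hz).1 rfl, fun hz => (hc _ hz).2.1 (by abel),
    fun hz => (hc _ hz).2.2 (by abel)⟩

variable {A L σ : Type*} [AddCommGroup A] [AddCommGroup L] [SetLike σ A] [AddSubgroupClass σ A]
  {N : σ}

theorem add_notMem_of_mem {x n : A} (hx : x ∉ N) (hn : n ∈ N) : x + n ∉ N :=
  mt (add_mem_cancel_right hn).1 hx

theorem neg_notMem {x : A} (hx : x ∉ N) : -x ∉ N :=
  mt neg_mem_iff.1 hx

/-- The bundled form of a map that is additive in each of its two arguments. -/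
def biadditive (f : A → A → L) (map_add_left : ∀ a b c, f (a + b) c = f a c + f b c)
    (map_add_right : ∀ a b c, f a (b + c) = f a b + f a c) : A →+ A →+ L :=
  AddMonoidHom.mk' (fun a => AddMonoidHom.mk' (f a) (map_add_right a))
    fun a b => AddMonoidHom.ext (map_add_left a b)

@[simp]
theorem biadditive_apply (f : A → A → L) (hl hr) (a b : A) : biadditive f hl hr a b = f a b := rfl

namespace UnitComplement

theorem add_or_sub_notMem (hN : UnitComplement N) {x : A} (hx : x ∉ N) (z : A) :
    x + z ∉ N ∨ x - z ∉ N := by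
  by_contra! h
  apply hN.two_nsmul x hx
  convert add_mem h.1 h.2 using 1
  abel

theorem inGeneralPosition_two_nsmul_add (hN : UnitComplement N) {x n : A} (hx : x ∉ N)
    (hn : n ∈ N) : InGeneralPosition N x (2 • x + n) := by
  refine ⟨add_notMem_of_mem (hN.two_nsmul x hx) hn, ?_, ?_⟩
  · convert add_notMem_of_mem (hN.three_nsmul x hx) hn using 2
    module
  · convert add_notMem_of_mem (neg_notMem hx) (neg_mem hn) using 2
    module

theorem eq_zero_of_inGeneralPosition (hN : UnitComplement N) (hL : IsSMulRegular L 2) (f : A →+ L)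
    {x : A} (hx : x ∉ N) (h : ∀ z, InGeneralPosition N x z → f z = 0) (z : A) : f z = 0 := by
  have two_nsmul_add : ∀ n ∈ N, 2 • f x + f n = 0 := fun n hn => by
    simpa using h _ (hN.inGeneralPosition_two_nsmul_add hx hn)
  have apply_x : f x = 0 := hL.right_eq_zero_of_smul (by simpa using two_nsmul_add 0 (zero_mem N))
  have apply_mem : ∀ n ∈ N, f n = 0 := fun n hn => by simpa [apply_x] using two_nsmul_add n hn
  by_cases hz : InGeneralPosition N x z
  · exact h z hz
  · obtain ⟨n, hn, h | h | h⟩ := exists_mem_of_not_inGeneralPosition hz <;>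
      simp [h, apply_x, apply_mem n hn]

theorem eq_zero_of_notMem (hN : UnitComplement N) (f : A →+ L) (h : ∀ x, x ∉ N → f x = 0)
    (x : A) : f x = 0 := by
  obtain ⟨e, he⟩ := hN.exists_notMem
  by_cases hx : x ∈ N
  · simpa [h e he] using h _ (add_notMem_of_mem he hx)
  · exact h x hx

theorem biadditive_eq_zero_of_notMem (hN : UnitComplement N) (hL : IsSMulRegular L 2)
    (f : A →+ A →+ L) (h : ∀ x z, x ∉ N → z ∉ N → x + z ∉ N → f x z = 0) (x z : A) :
    f x z = 0 :=
  hN.eq_zero_of_notMem (f.flip z)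
    (fun x hx => hN.eq_zero_of_inGeneralPosition hL (f x) hx
      (fun z hz => h x z hx hz.1 hz.2.1) z) x

/-- The values on the units `2x + n` already determine `f` on `ℤx + N`. -/
theorem apply_apply_eq_zero_of_mem (hN : UnitComplement N) (hL : IsSMulRegular L 2)
    (f : A →+ A →+ L) (hs : ∀ a b, f a b = f b a) {x : A} (hx : x ∉ N)
    (h : ∀ z, InGeneralPosition N x z → f z z = 0) :
    f x x = 0 ∧ ∀ n ∈ N, f n n = 0 ∧ f x n = 0 := by
  have two_nsmul_add : ∀ n ∈ N, 2 • 2 • f x x + 2 • 2 • f x n + f n n = 0 := fun n hn => by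
    have := h _ (hN.inGeneralPosition_two_nsmul_add hx hn)
    simp only [map_add, map_nsmul, AddMonoidHom.add_apply, AddMonoidHom.nsmul_apply, hs n x] at this
    linear_combination (norm := module) this
  have apply_x : f x x = 0 := hL.right_eq_zero_of_smul <| hL.right_eq_zero_of_smul <| by
    simpa using two_nsmul_add 0 (zero_mem N)
  refine ⟨apply_x, fun n hn => ?_⟩
  have apply_n : f n n = 0 := hL.right_eq_zero_of_smul <| by
    have hneg := two_nsmul_add (-n) (neg_mem hn)
    simp only [map_neg, AddMonoidHom.neg_apply, neg_neg] at hneg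
    linear_combination (norm := module) two_nsmul_add n hn + hneg - 2 • 2 • 2 • apply_x
  exact ⟨apply_n, hL.right_eq_zero_of_smul <| hL.right_eq_zero_of_smul <| by
    simpa [apply_x, apply_n] using two_nsmul_add n hn⟩

theorem symm_biadditive_eq_zero_of_inGeneralPosition (hN : UnitComplement N)
    (hL : IsSMulRegular L 2) (f : A →+ A →+ L) (hs : ∀ a b, f a b = f b a) {x : A} (hx : x ∉ N)
    (h : ∀ z, InGeneralPosition N x z → f z z = 0) (y z : A) : f y z = 0 := by
  obtain ⟨apply_x, apply_mem⟩ := hN.apply_apply_eq_zero_of_mem hL f hs hx h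
  have apply_self : ∀ z, f z z = 0 := fun z => by
    by_cases hz : InGeneralPosition N x z
    · exact h z hz
    · obtain ⟨n, hn, h | h | h⟩ := exists_mem_of_not_inGeneralPosition hz <;>
        simp [h, apply_x, apply_mem n hn, hs n x]
  have apply_add := apply_self (y + z)
  simp only [map_add, AddMonoidHom.add_apply, apply_self, hs z y, zero_add, add_zero] at apply_add
  exact hL.right_eq_zero_of_smul ((_root_.two_nsmul _).trans apply_add)

theorem symm_biadditive_eq_zero_of_notMem (hN : UnitComplement N) (hL : IsSMulRegular L 2)
    (f : A →+ A →+ L) (hs : ∀ a b, f a b = f b a) (h : ∀ x, x ∉ N → f x x = 0) (x z : A) :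
    f x z = 0 := by
  obtain ⟨e, he⟩ := hN.exists_notMem
  exact hN.symm_biadditive_eq_zero_of_inGeneralPosition hL f hs he (fun z hz => h z hz.1) x z

end UnitComplement

end Units

/-! ## From identities for units to the five-linear Jordan pair identity -/

section JordanUnits

variable {k A C : Type*} [CommRing k] [AddCommGroup A] [AddCommGroup C] [Module k A] [Module k C]

/-- One sign of `JordanUnits`. Here `S x z y` stands for `{x y z} / 2`, so that `y Q_x` is
`S x x y`; the elements outside `N` are the units, and `hat` sends a unit to the negative of its
Jordan inverse. In a local Moufang set, `hat x` is the point `x`, viewed in `V^{-σ}`. -/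
structure HalfJordanUnits (N : Submodule k A) (N' : Submodule k C) (hat : A → C) (hat' : C → A)
    (S : A →ₗ[k] A →ₗ[k] C →ₗ[k] A) (S' : C →ₗ[k] C →ₗ[k] A →ₗ[k] C) : Prop where
  units : UnitComplement N
  two_regular : IsSMulRegular A 2
  three_regular : IsSMulRegular A 3
  hat_notMem : ∀ x, x ∉ N → hat x ∉ N'
  hat_hat : ∀ x, x ∉ N → hat' (hat x) = x
  hat_neg : ∀ x, x ∉ N → hat (-x) = -hat x
  symm : ∀ x z, S x z = S z x
  apply_hat : ∀ x z, x ∉ N → S x z (hat x) = -z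
  quad_hat_quad : ∀ x y, x ∉ N → S' (hat x) (hat x) (S x x y) = y
  fundamental : ∀ x y z, x ∉ N → y ∉ N' →
    S (S x x y) (S x x y) z = S x x (S' y y (S x x z))
  quad_notMem : ∀ x y, x ∉ N → y ∉ N' → S x x y ∉ N
  polar_hat_quad_of_add : ∀ a b y, a ∉ N → b ∉ N → a + b ∉ N →
    S' (hat a) (hat b) (S a a y) = S' (hat b) (hat b) (S a b y)
  quad_add_sub_mem : ∀ x n y, x ∉ N → n ∈ N → S (x + n) (x + n) y - S x x y ∈ N

/-- A pair of trilinear maps that satisfies the Jordan pair identities which can be read off from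
the `μ`-maps of a local Moufang set, that is, identities in which the arguments of the quadratic
operators are units. -/
structure JordanUnits (N : Submodule k A) (N' : Submodule k C) (hat : A → C) (hat' : C → A)
    (S : A →ₗ[k] A →ₗ[k] C →ₗ[k] A) (S' : C →ₗ[k] C →ₗ[k] A →ₗ[k] C) : Prop
    extends HalfJordanUnits N N' hat hat' S S' where
  minus : HalfJordanUnits N' N hat' hat S' S

namespace JordanUnits

variable {N : Submodule k A} {N' : Submodule k C} {hat : A → C} {hat' : C → A}
  {S : A →ₗ[k] A →ₗ[k] C →ₗ[k] A} {S' : C →ₗ[k] C →ₗ[k] A →ₗ[k] C}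

theorem swap (h : JordanUnits N N' hat hat' S S') : JordanUnits N' N hat' hat S' S :=
  { h.minus with minus := h.toHalfJordanUnits }

theorem quad_quad_hat (h : JordanUnits N N' hat hat' S S') {x : A} (hx : x ∉ N) (z : A) :
    S x x (S' (hat x) (hat x) z) = z := by
  simpa only [h.hat_hat x hx] using h.swap.quad_hat_quad (hat x) z (h.hat_notMem x hx)

theorem hat_apply (h : JordanUnits N N' hat hat' S S') {x : A} (hx : x ∉ N) (y : C) :
    S' (hat x) y x = -y := by
  simpa only [h.hat_hat x hx] using h.swap.apply_hat (hat x) y (h.hat_notMem x hx)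

theorem fundamental_polar (h : JordanUnits N N' hat hat' S S') {x : A} (hx : x ∉ N) (y w z : C) :
    S (S x x y) (S x x w) z = S x x (S' y w (S x x z)) := by
  refine sub_eq_zero.1 (h.swap.units.symm_biadditive_eq_zero_of_notMem h.two_regular
    (biadditive (fun y w => S (S x x y) (S x x w) z - S x x (S' y w (S x x z))) ?_ ?_)
    (fun y w => ?_) (fun y hy => sub_eq_zero.2 (h.fundamental x y z hx hy)) y w)
  · intros; simp only [map_add, LinearMap.add_apply]; abel
  · intros; simp only [map_add, LinearMap.add_apply]; abel
  · simp only [biadditive_apply, h.symm (S x x y), h.swap.symm y]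

theorem polar_hat_quad (h : JordanUnits N N' hat hat' S S') {a b : A} (ha : a ∉ N) (hb : b ∉ N)
    (y : C) : S' (hat a) (hat b) (S a a y) = S' (hat b) (hat b) (S a b y) := by
  rcases h.units.add_or_sub_notMem ha b with hab | hab
  · exact h.polar_hat_quad_of_add a b y ha hb hab
  · simpa [h.hat_neg b hb] using
      h.polar_hat_quad_of_add a (-b) y ha (neg_notMem hb) (by rwa [← sub_eq_add_neg])

theorem polar_quad_hat (h : JordanUnits N N' hat hat' S S') {a b : A} (ha : a ∉ N) (hb : b ∉ N) :
    S b a (S' (hat b) (hat b) a) = -S a a (hat b) := by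
  have hba := h.polar_hat_quad hb ha (S' (hat b) (hat b) a)
  rw [h.quad_quad_hat hb, h.swap.symm, h.hat_apply ha] at hba
  rw [← map_neg, hba, h.quad_quad_hat ha]

theorem two_polar_hat (h : JordanUnits N N' hat hat' S S') {b : A} (hb : b ∉ N) (v z : A) :
    2 • S v z (hat b) + S b z (S' (hat b) (hat b) v) + S b v (S' (hat b) (hat b) z) = 0 := by
  refine h.units.symm_biadditive_eq_zero_of_notMem h.two_regular
    (biadditive (fun v z => 2 • S v z (hat b) + S b z (S' (hat b) (hat b) v)
      + S b v (S' (hat b) (hat b) z)) ?_ ?_) (fun v z => ?_) (fun a ha => ?_) v z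
  · intros; simp only [map_add, LinearMap.add_apply]; module
  · intros; simp only [map_add, LinearMap.add_apply]; module
  · simp only [biadditive_apply, h.symm v z, add_right_comm]
  · simp only [biadditive_apply, h.polar_quad_hat ha hb]; module

theorem two_polar_quad (h : JordanUnits N N' hat hat' S S') {b : A} (hb : b ∉ N) (y w : C) :
    S b (S b b w) y + S b (S b b y) w = 2 • S b b (S' y w b) := by
  have key := h.two_polar_hat hb (S b b y) (S b b w)
  rw [h.quad_hat_quad b y hb, h.quad_hat_quad b w hb, h.fundamental_polar hb, h.apply_hat b b hb,
    map_neg, map_neg] at key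
  linear_combination (norm := module) key

/-- The relation between the three products of degree `3` in `x` is linearized in `x`. -/
theorem cubic_linearization (h : JordanUnits N N' hat hat' S S') (y w : C) (p q r : ℤ)
    (cubic : ∀ x, x ∉ N →
      p • S x (S x x w) y + q • S x (S x x y) w + r • S x x (S' y w x) = 0)
    {x : A} (hx : x ∉ N) (z : A) :
    p • (S z (S x x w) y + 2 • S x (S x z w) y) + q • (S z (S x x y) w + 2 • S x (S x z y) w)
      + r • (2 • S x z (S' y w x) + S x x (S' y w z)) = 0 := by
  refine h.units.eq_zero_of_inGeneralPosition h.two_regular (AddMonoidHom.mk' (fun z =>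
    p • (S z (S x x w) y + 2 • S x (S x z w) y) + q • (S z (S x x y) w + 2 • S x (S x z y) w)
      + r • (2 • S x z (S' y w x) + S x x (S' y w z))) ?_) hx (fun z ⟨hz, hadd, hsub⟩ => ?_) z
  · intros; simp only [map_add, LinearMap.add_apply]; module
  · have cubic_add := cubic _ hadd
    have cubic_sub := cubic _ hsub
    simp only [map_add, map_sub, LinearMap.add_apply, LinearMap.sub_apply, h.symm z x]
      at cubic_add cubic_sub
    refine h.two_regular.right_eq_zero_of_smul ?_
    linear_combination (norm := (simp only [AddMonoidHom.mk'_apply]; module))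
      cubic_add - cubic_sub - 2 • cubic z hz

theorem apply_hat_eq_sub (h : JordanUnits N N' hat hat' S S') {b : A} (hb : b ∉ N) (v z : A) :
    S v z (hat b) = S b z (S' (hat b) (hat b) v) - 2 • S b v (S' (hat b) (hat b) z) := by
  have linearized := h.cubic_linearization (hat b) (S' (hat b) (hat b) v) 1 1 (-2)
    (fun x hx => by linear_combination (norm := module) h.two_polar_quad hx (hat b) _) hb z
  have quad_polar : S b b (S' (hat b) (S' (hat b) (hat b) v) z)
      = -S b v (S' (hat b) (hat b) z) := by
    rw [← LinearMap.neg_apply, ← map_neg, ← h.apply_hat b v hb]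
    simpa only [h.quad_quad_hat hb, h.apply_hat b _ hb, map_neg, LinearMap.neg_apply, neg_inj,
      eq_comm] using
      h.fundamental_polar hb (hat b) (S' (hat b) (hat b) v) (S' (hat b) (hat b) z)
  rw [h.quad_quad_hat hb, h.apply_hat b _ hb, h.apply_hat b _ hb, h.apply_hat b _ hb,
    h.hat_apply hb, quad_polar, h.symm z v, h.symm z (-b)] at linearized
  simp only [map_neg, LinearMap.neg_apply] at linearized
  linear_combination (norm := module) linearized

/-- In terms of `v' = v Q_b⁻¹`, this says that `{v b⁻¹ z} = {b v' z}`. -/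
theorem apply_apply_hat (h : JordanUnits N N' hat hat' S S') {b : A} (hb : b ∉ N) (v z : A) :
    S v z (hat b) = -S b z (S' (hat b) (hat b) v) := by
  have swapped := h.apply_hat_eq_sub hb z v
  rw [h.symm z v] at swapped
  have comm : S b z (S' (hat b) (hat b) v) = S b v (S' (hat b) (hat b) z) := by
    refine sub_eq_zero.1 (h.three_regular.right_eq_zero_of_smul ?_)
    linear_combination (norm := module) swapped - h.apply_hat_eq_sub hb v z
  linear_combination (norm := module) h.apply_hat_eq_sub hb v z + 2 • comm

theorem jp1_of_notMem (h : JordanUnits N N' hat hat' S S') {b : A} (hb : b ∉ N) (y w : C) :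
    S b (S b b w) y = S b b (S' y w b) := by
  have key := h.apply_apply_hat hb (S b b y) (S b b w)
  rw [h.fundamental_polar hb, h.quad_hat_quad b y hb, h.apply_hat b b hb, map_neg, map_neg] at key
  exact (neg_inj.1 key).symm

theorem jp1_linearized (h : JordanUnits N N' hat hat' S S') (x u z : A) (y w : C) :
    S z (S x u w) y + S x (S u z w) y + S u (S x z w) y
      = S x z (S' y w u) + S u z (S' y w x) + S x u (S' y w z) := by
  refine sub_eq_zero.1 (h.units.symm_biadditive_eq_zero_of_notMem h.two_regular
    (biadditive (fun x u => S z (S x u w) y + S x (S u z w) y + S u (S x z w) y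
      - (S x z (S' y w u) + S u z (S' y w x) + S x u (S' y w z))) ?_ ?_)
    (fun x u => ?_) (fun x hx => ?_) x u)
  · intros; simp only [map_add, LinearMap.add_apply]; abel
  · intros; simp only [map_add, LinearMap.add_apply]; abel
  · simp only [biadditive_apply, h.symm x u]; abel
  · linear_combination (norm := (simp only [biadditive_apply]; module))
      h.cubic_linearization y w 1 0 (-1) (fun x hx => by
        linear_combination (norm := module) h.jp1_of_notMem hx y w) hx z

/-- The part of the fundamental formula that has degree `2` in each of `x` and `v`. -/
theorem fundamental_part (h : JordanUnits N N' hat hat' S S') {x v : A} (hx : x ∉ N)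
    (hxv : InGeneralPosition N x v) {y : C} (hy : y ∉ N') (w : C) :
    2 • S (S x x y) (S v v y) w + 4 • S (S x v y) (S x v y) w
      = S x x (S' y y (S v v w)) + S v v (S' y y (S x x w)) + 4 • S x v (S' y y (S x v w)) := by
  have add := h.fundamental (x + v) y w hxv.2.1 hy
  have sub := h.fundamental (x - v) y w hxv.2.2 hy
  simp only [map_add, map_sub, LinearMap.add_apply, LinearMap.sub_apply, h.symm v x,
    h.symm (S v v y) (S x x y), h.symm (S x v y) (S x x y), h.symm (S v v y) (S x v y)] at add sub
  refine sub_eq_zero.1 (h.two_regular.right_eq_zero_of_smul ?_)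
  linear_combination (norm := module)
    add + sub - 2 • h.fundamental x y w hx hy - 2 • h.fundamental v y w hxv.1 hy

theorem quad_eq_of_inGeneralPosition (h : JordanUnits N N' hat hat' S S') {x v : A} (hx : x ∉ N)
    (hxv : InGeneralPosition N x v) (t : A) :
    S v v (S' (hat x) (hat x) t)
      = 2 • S (S t v (hat x)) v (hat x) - S t (S v v (hat x)) (hat x) := by
  have key := h.fundamental_part hx hxv (h.hat_notMem x hx) (S' (hat x) (hat x) t)
  have polar : ∀ s u, S x u (S' (hat x) (hat x) s) = -S s u (hat x) := fun s u => by
    rw [h.apply_apply_hat hx s, neg_neg]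
  rw [h.apply_hat x x hx, h.apply_hat x v hx, h.quad_quad_hat hx, h.quad_quad_hat hx] at key
  simp only [map_neg, LinearMap.neg_apply, polar, neg_neg] at key
  refine sub_eq_zero.1 (h.two_regular.right_eq_zero_of_smul ?_)
  linear_combination (norm := module) key

/-- In the Jordan algebra with unit element `x⁻¹` and product `s ∘ z = {s x z} / 2` obtained from
the pair, this is `{s t z} / 2 = s ∘ (z ∘ t) + z ∘ (s ∘ t) - t ∘ (s ∘ z)`. -/
theorem apply_quad_hat (h : JordanUnits N N' hat hat' S S') {x : A} (hx : x ∉ N) (s z t : A) :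
    S s z (S' (hat x) (hat x) t) = S s (S z t (hat x)) (hat x) + S z (S s t (hat x)) (hat x)
      - S t (S s z (hat x)) (hat x) := by
  refine sub_eq_zero.1 (h.units.symm_biadditive_eq_zero_of_inGeneralPosition h.two_regular
    (biadditive (fun s z => S s z (S' (hat x) (hat x) t) - (S s (S z t (hat x)) (hat x)
      + S z (S s t (hat x)) (hat x) - S t (S s z (hat x)) (hat x))) ?_ ?_)
    (fun s z => ?_) hx (fun v hxv => ?_) s z)
  · intros; simp only [map_add, LinearMap.add_apply]; abel
  · intros; simp only [map_add, LinearMap.add_apply]; abel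
  · simp only [biadditive_apply, h.symm s z]; abel
  · rw [biadditive_apply, h.quad_eq_of_inGeneralPosition hx hxv, h.symm v t,
      h.symm v (S t v (hat x))]
    module

theorem jp2_of_notMem (h : JordanUnits N N' hat hat' S S') {x : A} (hx : x ∉ N) (z : A)
    (y v : C) : S (S x x y) z v + S (S x x v) z y = 2 • S x z (S' y v x) := by
  have hv := h.apply_quad_hat hx (S x x y) z (S x x v)
  have hy := h.apply_quad_hat hx (S x x v) z (S x x y)
  have polar : S (S x x y) (S x x v) (hat x) = -S x x (S' y v x) := by
    rw [h.fundamental_polar hx, h.apply_hat x x hx, map_neg, map_neg]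
  have polar' : S z (S x x (S' y v x)) (hat x) = -S x z (S' y v x) := by
    rw [h.symm z, h.apply_apply_hat hx, h.quad_hat_quad x _ hx]
  rw [h.quad_hat_quad x v hx, h.symm (S x x y) z, polar, map_neg, LinearMap.neg_apply, polar'] at hv
  rw [h.quad_hat_quad x y hx, h.symm (S x x v) (S x x y), h.symm (S x x v) z, polar, map_neg,
    LinearMap.neg_apply, polar'] at hy
  rw [h.symm (S x x y) z, h.symm (S x x v) z]
  linear_combination (norm := module) hv + hy

theorem jp2_linearized (h : JordanUnits N N' hat hat' S S') (x u z : A) (y v : C) :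
    S (S x u y) z v + S (S x u v) z y = S x z (S' y v u) + S u z (S' y v x) := by
  refine sub_eq_zero.1 (h.units.symm_biadditive_eq_zero_of_notMem h.two_regular
    (biadditive (fun x u => S (S x u y) z v + S (S x u v) z y
      - (S x z (S' y v u) + S u z (S' y v x))) ?_ ?_) (fun x u => ?_) (fun x hx => ?_) x u)
  · intros; simp only [map_add, LinearMap.add_apply]; abel
  · intros; simp only [map_add, LinearMap.add_apply]; abel
  · simp only [biadditive_apply, h.symm x u]; abel
  · rw [biadditive_apply, h.jp2_of_notMem hx]
    module

theorem five_linear (h : JordanUnits N N' hat hat' S S') (x u z : A) (y v : C) :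
    S x (S u z v) y - S u (S x z y) v = S (S x u y) z v - S u z (S' y v x) := by
  have jp1 := h.jp1_linearized u z x v y
  have jp2 := h.jp2_linearized u z x y v
  rw [h.symm (S u z y) x, h.symm (S u z v) x, h.symm z x] at jp2
  rw [h.swap.symm v y, h.symm z x] at jp1
  rw [h.symm x u, h.symm (S u x y) z]
  linear_combination (norm := module) jp2 - jp1

end JordanUnits

end JordanUnits

/-! ## Jordan pairs from the five-linear identity -/

namespace JordanPair

section FiveLinear

variable {k : Type*} [CommRing k] {A : Type*} {C : Type*} [AddCommGroup A] [AddCommGroup C]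
  [Module k A] [Module k C]

/-- The five-linear identity, which characterizes the halved triple products `S x z y = {x y z} / 2`
of Jordan pairs without `2`- and `3`-torsion. -/
structure FiveLinear (S : A →ₗ[k] A →ₗ[k] C →ₗ[k] A) (S' : C →ₗ[k] C →ₗ[k] A →ₗ[k] C) : Prop where
  symm : ∀ x z, S x z = S z x
  symm' : ∀ y v, S' y v = S' v y
  identity : ∀ (x u z : A) (y v : C),
    S x (S u z v) y - S u (S x z y) v = S (S x u y) z v - S u z (S' y v x)
  identity' : ∀ (y v w : C) (x u : A),
    S' y (S' v w u) x - S' v (S' y w x) u = S' (S' y v x) w u - S' v w (S x u y)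

variable {S : A →ₗ[k] A →ₗ[k] C →ₗ[k] A} {S' : C →ₗ[k] C →ₗ[k] A →ₗ[k] C}

theorem triple_toQuadraticMap (symm : ∀ x z, S x z = S z x) (x : A) (y : C) (z : A) :
    triple (LinearMap.BilinMap.toQuadraticMap S) x y z = 2 • S x z y := by
  simp only [triple, LinearMap.BilinMap.toQuadraticMap_apply, map_add, LinearMap.add_apply,
    LinearMap.sub_apply, symm z x]
  abel

namespace FiveLinear

theorem swap (h : FiveLinear S S') : FiveLinear S' S :=
  ⟨h.symm', h.symm, h.identity', h.identity⟩

theorem jp1 (h : FiveLinear S S') (hA : IsSMulRegular A 3) (x : A) (y v : C) :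
    S x (S x x v) y = S x x (S' y v x) := by
  have identity_yv := h.identity x x x y v
  have identity_vy := h.identity x x x v y
  rw [h.symm (S x x y) x] at identity_yv
  rw [h.symm (S x x v) x, h.swap.symm v y] at identity_vy
  have comm : S x (S x x v) y - S x (S x x y) v = 0 := hA.right_eq_zero_of_smul <| by
    linear_combination (norm := module) identity_yv - identity_vy
  linear_combination (norm := module) 2 • comm - identity_yv

theorem jp2 (h : FiveLinear S S') (x z : A) (y : C) : S (S x x y) z y = S x z (S' y y x) := by
  linear_combination (norm := module) -h.identity x x z y y

theorem apply_quad (h : FiveLinear S S') (x u : A) (y v : C) :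
    S u (S x x y) v = 2 • S x (S u x v) y - S x x (S' v y u) := by
  have identity := h.identity u x x v y
  rw [h.symm (S u x v) x] at identity
  linear_combination (norm := module) identity

theorem jp3 (h : FiveLinear S S') (hA : IsSMulRegular A 3) (x : A) (y w : C) :
    S (S x x y) (S x x y) w = S x x (S' y y (S x x w)) := by
  calc S (S x x y) (S x x y) w
    _ = S x x (2 • S' y (S' y w x) x - S' w (S' y y x) x) := by
      rw [h.apply_quad x (S x x y) y w, h.symm (S x x y) x, h.jp1 hA, h.jp1 hA, h.swap.symm w y,
        ← h.swap.jp2 y w x, h.swap.symm (S' y y x) w, map_sub, map_nsmul]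
    _ = S x x (S' y y (S x x w)) := by
      rw [h.swap.apply_quad y w x x, h.swap.symm w y]
      abel_nf

theorem identities (h : FiveLinear S S') (hA : IsSMulRegular A 3) :
    Identities (LinearMap.BilinMap.toQuadraticMap S) (LinearMap.BilinMap.toQuadraticMap S') where
  jp1 x y z := by
    simp only [triple_toQuadraticMap h.symm, triple_toQuadraticMap h.swap.symm,
      LinearMap.BilinMap.toQuadraticMap_apply, map_nsmul, h.jp1 hA]
  jp2 x z y := by
    simp only [triple_toQuadraticMap h.symm, LinearMap.BilinMap.toQuadraticMap_apply, h.jp2]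
  jp3 x y z := by
    simp only [LinearMap.BilinMap.toQuadraticMap_apply, h.jp3 hA]

end FiveLinear

section BaseChange

variable (l : Type*) [CommRing l] [Algebra k l]

/-- The scalar extension of a trilinear map. -/
noncomputable def trilinearBaseChange (S : A →ₗ[k] A →ₗ[k] C →ₗ[k] A) :
    l ⊗[k] A →ₗ[l] l ⊗[k] A →ₗ[l] l ⊗[k] C →ₗ[l] l ⊗[k] A :=
  (LinearMap.BilinMap.baseChange l S).compr₂
    (LinearMap.liftBaseChange l (LinearMap.baseChangeHom k l C A))

theorem trilinearBaseChange_tmul (S : A →ₗ[k] A →ₗ[k] C →ₗ[k] A) (a b c : l) (x z : A) (y : C) :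
    trilinearBaseChange l S (a ⊗ₜ x) (b ⊗ₜ z) (c ⊗ₜ y) = (a * b * c) ⊗ₜ S x z y := by
  simp [trilinearBaseChange, TensorProduct.smul_tmul', mul_comm]

variable {l}

theorem eq_zero_of_apply_one_tmul {L : Type*} [AddCommGroup L] [Module l L] {f : l ⊗[k] A → L}
    (hf : IsLinearMap l f) (h : ∀ x, f (1 ⊗ₜ x) = 0) (p : l ⊗[k] A) : f p = 0 := by
  induction p using TensorProduct.induction_on with
  | zero => exact hf.map_zero
  | tmul a x =>
    rw [← mul_one a, ← smul_eq_mul, ← TensorProduct.smul_tmul', hf.map_smul, h, smul_zero]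
  | add p q hp hq => rw [hf.map_add, hp, hq, add_zero]

variable (l)

theorem trilinearBaseChange_symm (symm : ∀ x z, S x z = S z x) (x z : l ⊗[k] A) :
    trilinearBaseChange l S x z = trilinearBaseChange l S z x := by
  let defect x z := trilinearBaseChange l S x z - trilinearBaseChange l S z x
  have pure_tensors (x z : A) : defect (1 ⊗ₜ x) (1 ⊗ₜ z) = 0 := by
    ext y
    simp [defect, trilinearBaseChange_tmul, symm x z]
  refine sub_eq_zero.1 <|
    eq_zero_of_apply_one_tmul (f := fun x => defect x z) ?_ (fun x =>
    eq_zero_of_apply_one_tmul (f := defect (1 ⊗ₜ x)) ?_ (pure_tensors x) z) x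
  all_goals
    constructor <;> intros <;>
      simp only [defect, map_add, map_smul, LinearMap.add_apply, LinearMap.smul_apply] <;> module

namespace FiveLinear

theorem identity_baseChange (h : FiveLinear S S') (x u z : l ⊗[k] A) (y v : l ⊗[k] C) :
    trilinearBaseChange l S x (trilinearBaseChange l S u z v) y
        - trilinearBaseChange l S u (trilinearBaseChange l S x z y) v
      = trilinearBaseChange l S (trilinearBaseChange l S x u y) z v
        - trilinearBaseChange l S u z (trilinearBaseChange l S' y v x) := by
  let T := trilinearBaseChange l S
  let T' := trilinearBaseChange l S'
  let defect x u z y v := T x (T u z v) y - T u (T x z y) v - (T (T x u y) z v - T u z (T' y v x))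
  have pure_tensors (x u z : A) (y v : C) :
      defect (1 ⊗ₜ x) (1 ⊗ₜ u) (1 ⊗ₜ z) (1 ⊗ₜ y) (1 ⊗ₜ v) = 0 := by
    simp only [defect, T, T', trilinearBaseChange_tmul, mul_one, ← TensorProduct.tmul_sub,
      h.identity, sub_self]
  refine sub_eq_zero.1 <|
    eq_zero_of_apply_one_tmul (f := fun x => defect x u z y v) ?_ (fun x =>
    eq_zero_of_apply_one_tmul (f := fun u => defect (1 ⊗ₜ x) u z y v) ?_ (fun u =>
    eq_zero_of_apply_one_tmul (f := fun z => defect (1 ⊗ₜ x) (1 ⊗ₜ u) z y v) ?_ (fun z =>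
    eq_zero_of_apply_one_tmul (f := fun y => defect (1 ⊗ₜ x) (1 ⊗ₜ u) (1 ⊗ₜ z) y v) ?_ (fun y =>
    eq_zero_of_apply_one_tmul (f := defect (1 ⊗ₜ x) (1 ⊗ₜ u) (1 ⊗ₜ z) (1 ⊗ₜ y)) ?_
      (pure_tensors x u z y) v) y) z) u) x
  all_goals
    constructor <;> intros <;>
      simp only [defect, map_add, map_smul, LinearMap.add_apply, LinearMap.smul_apply] <;> module

theorem baseChange (h : FiveLinear S S') :
    FiveLinear (trilinearBaseChange l S) (trilinearBaseChange l S') where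
  symm := trilinearBaseChange_symm l h.symm
  symm' := trilinearBaseChange_symm l h.swap.symm
  identity := h.identity_baseChange l
  identity' := h.swap.identity_baseChange l

end FiveLinear

theorem isSMulRegular_baseChange {n : ℕ} (hn : Function.Bijective fun a : A => n • a) :
    IsSMulRegular (l ⊗[k] A) n := by
  let f : A ≃ₗ[k] A := LinearEquiv.ofBijective (n • LinearMap.id) hn
  have apply_eq (p : l ⊗[k] A) : f.baseChange k l A A p = n • p := by
    induction p using TensorProduct.induction_on with
    | zero => simp
    | add p q hp hq => rw [map_add, hp, hq, smul_add]
    | tmul a x => exact TensorProduct.tmul_smul n a x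
  intro p q hpq
  simp only [← apply_eq] at hpq
  exact (f.baseChange k l A A).injective hpq

theorem isScalarExtension_toQuadraticMap (S : A →ₗ[k] A →ₗ[k] C →ₗ[k] A) :
    IsScalarExtension (LinearMap.BilinMap.toQuadraticMap S)
      (LinearMap.BilinMap.toQuadraticMap (trilinearBaseChange l S)) := fun x y => by
  simp [trilinearBaseChange_tmul]

end BaseChange

theorem FiveLinear.isJordanPair (h : FiveLinear S S') (hA : Function.Bijective fun a : A => 3 • a)
    (hC : Function.Bijective fun c : C => 3 • c) :
    IsJordanPair.{t} (LinearMap.BilinMap.toQuadraticMap S)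
      (LinearMap.BilinMap.toQuadraticMap S') :=
  ⟨h.identities hA.1, h.swap.identities hC.1, fun l _ _ =>
    ⟨LinearMap.BilinMap.toQuadraticMap (trilinearBaseChange l S),
      LinearMap.BilinMap.toQuadraticMap (trilinearBaseChange l S'),
      isScalarExtension_toQuadraticMap l S, isScalarExtension_toQuadraticMap l S',
      (h.baseChange l).identities (isSMulRegular_baseChange l hA),
      (h.baseChange l).swap.identities (isSMulRegular_baseChange l hC)⟩⟩

end FiveLinear

end JordanPair

/-! ## Locality and the Jacobson radical -/

section Bergman

variable {k A C : Type*} [CommRing k] [AddCommGroup A] [AddCommGroup C] [Module k A] [Module k C]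

namespace JordanPair

variable {S : A →ₗ[k] A →ₗ[k] C →ₗ[k] A} {S' : C →ₗ[k] C →ₗ[k] A →ₗ[k] C}

/-- The Bergman operator `z ↦ z - {x y z} + z Q_y Q_x` of the pair with `S x z y = {x y z} / 2` and
`S x x y = y Q_x`, as a linear map. -/
def bergmanMap (S : A →ₗ[k] A →ₗ[k] C →ₗ[k] A) (S' : C →ₗ[k] C →ₗ[k] A →ₗ[k] C) (x : A) (y : C) :
    A →ₗ[k] A :=
  LinearMap.id - 2 • (S x).flip y + S x x ∘ₗ S' y y

theorem bergmanMap_apply (x : A) (y : C) (z : A) :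
    bergmanMap S S' x y z = z - 2 • S x z y + S x x (S' y y z) := rfl

theorem bergman_toQuadraticMap (symm : ∀ x z, S x z = S z x) (x : A) (y : C) :
    bergman (LinearMap.BilinMap.toQuadraticMap S) (LinearMap.BilinMap.toQuadraticMap S') x y
      = bergmanMap S S' x y := by
  ext z
  simp only [bergman, triple_toQuadraticMap symm, bergmanMap_apply,
    LinearMap.BilinMap.toQuadraticMap_apply]

theorem bergmanMap_add_zsmul (symm : ∀ y v, S' y v = S' v y) (x : A) (y u : C) (c : ℤ) (z : A) :
    bergmanMap S S' x (y + c • u) z = bergmanMap S S' x y z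
      + c • (2 • S x x (S' y u z) - 2 • S x z u) + c ^ 2 • S x x (S' u u z) := by
  simp only [bergmanMap_apply, map_add, LinearMap.add_apply, map_zsmul, LinearMap.smul_apply,
    symm u y]
  module

theorem bergmanMap_add_zsmul_left (symm : ∀ y v, S' y v = S' v y) (y u : C) (x : A) (c : ℤ)
    (w : C) :
    bergmanMap S' S (y + c • u) x w = bergmanMap S' S y x w
      + c • (2 • S' y u (S x x w) - 2 • S' u w x) + c ^ 2 • S' u u (S x x w) := by
  simp only [bergmanMap_apply, map_add, LinearMap.add_apply, map_zsmul, LinearMap.smul_apply,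
    symm u y]
  module

/-- The defect of the identity `Q_{z B_{x,y}} = B_{y,x} Q_z B_{x,y}` at `w` has degree at most `4`
in `y`, and its part of degree `4` vanishes because of `Q_{z Q_y Q_x} = Q_x Q_y Q_z Q_y Q_x`. -/
theorem FiveLinear.exists_cubic_bergmanMap_defect (h : FiveLinear S S') (hA : IsSMulRegular A 3)
    (hC : IsSMulRegular C 3) (x z : A) (y u w : C) :
    ∃ p₁ p₂ p₃ : A, ∀ c : ℤ,
      S (bergmanMap S S' x (y + c • u) z) (bergmanMap S S' x (y + c • u) z) w
          - bergmanMap S S' x (y + c • u) (S z z (bergmanMap S' S (y + c • u) x w))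
        = S (bergmanMap S S' x y z) (bergmanMap S S' x y z) w
          - bergmanMap S S' x y (S z z (bergmanMap S' S y x w))
          + c • p₁ + c ^ 2 • p₂ + c ^ 3 • p₃ := by
  let B₁ : A →ₗ[k] A := 2 • S x x ∘ₗ S' y u - 2 • (S x).flip u
  let B₂ : A →ₗ[k] A := S x x ∘ₗ S' u u
  let D₁ : C := 2 • S' y u (S x x w) - 2 • S' u w x
  let D₂ : C := S' u u (S x x w)
  have quartic : S (B₂ z) (B₂ z) w = B₂ (S z z D₂) := by
    simp only [B₂, D₂, LinearMap.comp_apply, h.jp3 hA, h.swap.jp3 hC]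
  have expand (c : ℤ) (v : A) : bergmanMap S S' x (y + c • u) v
      = bergmanMap S S' x y v + c • B₁ v + c ^ 2 • B₂ v :=
    bergmanMap_add_zsmul h.swap.symm x y u c v
  generalize bergmanMap S S' x y = B₀ at *
  simp only [expand, bergmanMap_add_zsmul_left h.swap.symm]
  change ∃ p₁ p₂ p₃ : A, ∀ c : ℤ, _ - (B₀ (S z z (_ + c • D₁ + c ^ 2 • D₂))
    + c • B₁ (S z z (_ + c • D₁ + c ^ 2 • D₂))
    + c ^ 2 • B₂ (S z z (_ + c • D₁ + c ^ 2 • D₂))) = _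
  generalize bergmanMap S' S y x w = D₀
  clear_value B₁ B₂ D₁ D₂
  refine ⟨2 • S (B₀ z) (B₁ z) w - (B₀ (S z z D₁) + B₁ (S z z D₀)),
    S (B₁ z) (B₁ z) w + 2 • S (B₀ z) (B₂ z) w
      - (B₀ (S z z D₂) + B₁ (S z z D₁) + B₂ (S z z D₀)),
    2 • S (B₁ z) (B₂ z) w - (B₁ (S z z D₂) + B₂ (S z z D₁)), fun c => ?_⟩
  simp only [map_add, LinearMap.add_apply, map_zsmul, LinearMap.smul_apply, quartic,
    h.symm (B₁ z) (B₀ z), h.symm (B₂ z) (B₀ z), h.symm (B₂ z) (B₁ z)]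
  module

end JordanPair

theorem eq_zero_of_cubic_eq_zero {L : Type*} [AddCommGroup L] (hL₂ : IsSMulRegular L 2)
    (hL₃ : IsSMulRegular L 3) {p₀ p₁ p₂ p₃ : L}
    (h : ∀ c ∈ ({1, -1, 2, -2} : Set ℤ), p₀ + c • p₁ + c ^ 2 • p₂ + c ^ 3 • p₃ = 0) :
    p₀ = 0 := by
  have h₁ := h 1 (by simp)
  have h₂ := h (-1) (by simp)
  have h₃ := h 2 (by simp)
  have h₄ := h (-2) (by simp)
  refine hL₂.right_eq_zero_of_smul (hL₃.right_eq_zero_of_smul ?_)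
  linear_combination (norm := module) 4 • (h₁ + h₂) - (h₃ + h₄)

open JordanPair

namespace JordanUnits

variable {N : Submodule k A} {N' : Submodule k C} {hat : A → C} {hat' : C → A}
  {S : A →ₗ[k] A →ₗ[k] C →ₗ[k] A} {S' : C →ₗ[k] C →ₗ[k] A →ₗ[k] C}

theorem fiveLinear (h : JordanUnits N N' hat hat' S S') : FiveLinear S S' :=
  ⟨h.symm, h.swap.symm, h.five_linear, h.swap.five_linear⟩

theorem mem_of_two_nsmul_mem (h : JordanUnits N N' hat hat' S S') {x : A} (hx : 2 • x ∈ N) :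
    x ∈ N :=
  not_imp_not.1 (h.units.two_nsmul x) hx

theorem quad_mem (h : JordanUnits N N' hat hat' S S') {n : A} (hn : n ∈ N) (y : C) :
    S n n y ∈ N := by
  obtain ⟨e, he⟩ := h.units.exists_notMem
  refine h.mem_of_two_nsmul_mem ?_
  convert N.add_mem (h.quad_add_sub_mem e n y he hn)
    (h.quad_add_sub_mem e (-n) y he (neg_mem hn)) using 1
  simp only [map_add, LinearMap.add_apply, map_neg, LinearMap.neg_apply]
  module

theorem apply_mem (h : JordanUnits N N' hat hat' S S') {n : A} (hn : n ∈ N) (z : A) (y : C) :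
    S n z y ∈ N := by
  have apply_unit_mem {e : A} (he : e ∉ N) : S n e y ∈ N := by
    refine h.mem_of_two_nsmul_mem ?_
    convert N.sub_mem (h.quad_add_sub_mem e n y he hn) (h.quad_mem hn y) using 1
    simp only [map_add, LinearMap.add_apply, h.symm e n]
    module
  by_cases hz : z ∈ N
  · obtain ⟨e, he⟩ := h.units.exists_notMem
    have := apply_unit_mem (add_notMem_of_mem he hz)
    rwa [map_add, LinearMap.add_apply, N.add_mem_iff_right (apply_unit_mem he)] at this
  · exact apply_unit_mem hz

theorem quad_mem_right (h : JordanUnits N N' hat hat' S S') (x : A) {n : C} (hn : n ∈ N') :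
    S x x n ∈ N := by
  by_cases hx : x ∈ N
  · exact h.quad_mem hx n
  · by_contra hc
    have := h.swap.quad_notMem (hat x) _ (h.hat_notMem x hx) hc
    rw [h.quad_hat_quad x n hx] at this
    exact this hn

theorem apply_mem_right (h : JordanUnits N N' hat hat' S S') (x z : A) {n : C} (hn : n ∈ N') :
    S x z n ∈ N := by
  refine h.mem_of_two_nsmul_mem ?_
  convert N.sub_mem (N.sub_mem (h.quad_mem_right (x + z) hn) (h.quad_mem_right x hn))
    (h.quad_mem_right z hn) using 1
  simp only [map_add, LinearMap.add_apply, h.symm z x]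
  module

theorem bergmanMap_hat (h : JordanUnits N N' hat hat' S S') {b : A} (hb : b ∉ N) (x z : A) :
    bergmanMap S S' x (hat b) z = S (b + x) (b + x) (S' (hat b) (hat b) z) := by
  simp only [bergmanMap_apply, map_add, LinearMap.add_apply, h.quad_quad_hat hb, h.symm x b,
    h.symm x z, h.apply_apply_hat hb z x]
  module

theorem bergmanMap_hat_left (h : JordanUnits N N' hat hat' S S') {b : A} (hb : b ∉ N) (x : A)
    (s : C) : bergmanMap S' S (hat b) x s = S' (hat b) (hat b) (S (b + x) (b + x) s) := by
  have polar : S' (hat b) (hat b) (S b x s) = -S' (hat b) s x := by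
    have apply_eq := h.apply_apply_hat hb (S b b s) x
    rw [h.quad_hat_quad b s hb, h.symm] at apply_eq
    have jp1 := h.swap.jp1_of_notMem (h.hat_notMem b hb) x (S b b s)
    rw [h.quad_hat_quad b s hb, apply_eq, map_neg] at jp1
    rw [jp1, neg_neg]
  simp only [bergmanMap_apply, map_add, LinearMap.add_apply, h.quad_hat_quad b _ hb, h.symm x b,
    polar]
  module

theorem quad_bergmanMap_of_notMem (h : JordanUnits N N' hat hat' S S') (x z : A) {y : C}
    (hy : y ∉ N') (w : C) :
    S (bergmanMap S S' x y z) (bergmanMap S S' x y z) w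
      = bergmanMap S S' x y (S z z (bergmanMap S' S y x w)) := by
  obtain ⟨b, hb, rfl⟩ : ∃ b, b ∉ N ∧ hat b = y :=
    ⟨hat' y, h.swap.hat_notMem y hy, h.swap.hat_hat y hy⟩
  rw [h.bergmanMap_hat hb, h.bergmanMap_hat hb, h.bergmanMap_hat_left hb,
    h.fiveLinear.jp3 h.three_regular, h.swap.fiveLinear.jp3 h.swap.three_regular]

theorem quad_bergmanMap (h : JordanUnits N N' hat hat' S S') (x z : A) (y w : C) :
    S (bergmanMap S S' x y z) (bergmanMap S S' x y z) w
      = bergmanMap S S' x y (S z z (bergmanMap S' S y x w)) := by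
  by_cases hy : y ∈ N'
  · obtain ⟨u, hu⟩ := h.swap.units.exists_notMem
    obtain ⟨p₁, p₂, p₃, defect_eq⟩ := h.fiveLinear.exists_cubic_bergmanMap_defect
      h.three_regular h.swap.three_regular x z y u w
    refine sub_eq_zero.1 (eq_zero_of_cubic_eq_zero h.two_regular h.three_regular
      fun c hc => (defect_eq c).symm.trans (sub_eq_zero.2 (h.quad_bergmanMap_of_notMem x z ?_ w)))
    rw [add_comm]
    refine add_notMem_of_mem ?_ hy
    have h2u : (2 : ℤ) • u ∉ N' := by
      simpa only [two_smul] using h.swap.units.two_nsmul u hu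
    rcases hc with rfl | rfl | rfl | rfl
    · rwa [one_smul]
    · simpa using hu
    · exact h2u
    · rw [neg_smul]
      exact neg_notMem h2u
  · exact h.quad_bergmanMap_of_notMem x z hy w

theorem bergmanMap_sub_mem_of_left_mem (h : JordanUnits N N' hat hat' S S') {x : A} (hx : x ∈ N)
    (y : C) (z : A) : bergmanMap S S' x y z - z ∈ N := by
  convert N.sub_mem (h.quad_mem hx (S' y y z)) (nsmul_mem (h.apply_mem hx z y) 2) using 1
  rw [bergmanMap_apply]
  module

theorem bergmanMap_sub_mem_of_right_mem (h : JordanUnits N N' hat hat' S S') (x : A) {y : C}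
    (hy : y ∈ N') (z : A) : bergmanMap S S' x y z - z ∈ N := by
  convert N.sub_mem (h.quad_mem_right x (h.swap.quad_mem hy z))
    (nsmul_mem (h.apply_mem_right x z hy) 2) using 1
  rw [bergmanMap_apply]
  module

theorem exists_bergmanMap_notMem (h : JordanUnits N N' hat hat' S S') {x : A} {y : C}
    (hxy : x ∈ N ∨ y ∈ N') : ∃ z, bergmanMap S S' x y z ∉ N := by
  obtain ⟨z, hz⟩ := h.units.exists_notMem
  refine ⟨z, add_sub_cancel z (bergmanMap S S' x y z) ▸ add_notMem_of_mem hz ?_⟩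
  exact hxy.elim (fun hx => h.bergmanMap_sub_mem_of_left_mem hx y z)
    fun hy => h.bergmanMap_sub_mem_of_right_mem x hy z

theorem bergmanMap_bijective (h : JordanUnits N N' hat hat' S S') {x : A} {y : C}
    (hxy : x ∈ N ∨ y ∈ N') : Function.Bijective (bergmanMap S S' x y) := by
  constructor
  · rw [injective_iff_map_eq_zero]
    intro v hv
    obtain ⟨w, hw⟩ := h.swap.exists_bergmanMap_notMem hxy.symm
    have quad_eq := h.swap.quad_bergmanMap y w x v
    rw [hv, map_zero, map_zero] at quad_eq
    rw [← h.swap.quad_hat_quad _ v hw, quad_eq, map_zero]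
  · intro a
    obtain ⟨z, hz⟩ := h.exists_bergmanMap_notMem hxy
    have quad_eq := h.quad_quad_hat hz a
    rw [h.quad_bergmanMap] at quad_eq
    exact ⟨_, quad_eq⟩

theorem bergmanMap_neg_hat (h : JordanUnits N N' hat hat' S S') {x : A} (hx : x ∉ N) :
    bergmanMap S S' x (-hat x) = 0 := by
  ext z
  simp only [bergmanMap_apply, map_neg, LinearMap.neg_apply, h.apply_hat x z hx, neg_neg,
    h.quad_quad_hat hx, LinearMap.zero_apply]
  module

theorem not_bijective_zero (h : JordanUnits N N' hat hat' S S') :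
    ¬ Function.Bijective (0 : A →ₗ[k] A) := fun h0 => by
  obtain ⟨e, he⟩ := h.units.exists_notMem
  exact he (h0.1 (a₁ := e) (a₂ := 0) rfl ▸ N.zero_mem)

theorem radPlus_eq (h : JordanUnits N N' hat hat' S S') :
    radPlus (LinearMap.BilinMap.toQuadraticMap S) (LinearMap.BilinMap.toQuadraticMap S') = N := by
  ext x
  simp only [radPlus, IsQuasiInvertible, bergman_toQuadraticMap h.symm, Set.mem_ofPred_eq,
    SetLike.mem_coe]
  refine ⟨fun bijective => by_contra fun hx => ?_, fun hx y => h.bergmanMap_bijective (.inl hx)⟩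
  exact h.not_bijective_zero (h.bergmanMap_neg_hat hx ▸ bijective _)

theorem radMinus_eq (h : JordanUnits N N' hat hat' S S') :
    radMinus (LinearMap.BilinMap.toQuadraticMap S) (LinearMap.BilinMap.toQuadraticMap S') = N' := by
  ext y
  simp only [radMinus, IsQuasiInvertible, bergman_toQuadraticMap h.symm, Set.mem_ofPred_eq,
    SetLike.mem_coe]
  refine ⟨fun bijective => by_contra fun hy => ?_, fun hy x => h.bergmanMap_bijective (.inr hy)⟩
  have hy' := h.swap.hat_notMem y hy
  have bergman_zero := h.bergmanMap_neg_hat (neg_notMem hy')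
  rw [h.hat_neg _ hy', h.swap.hat_hat y hy, neg_neg] at bergman_zero
  exact h.not_bijective_zero (bergman_zero ▸ bijective _)

theorem not_isInvertible_iff (h : JordanUnits N N' hat hat' S S') (x : A) :
    ¬ IsInvertible (LinearMap.BilinMap.toQuadraticMap S) x ↔ x ∈ N := by
  rw [not_iff_comm]
  refine ⟨fun hx => ⟨?_, fun a => ⟨_, h.quad_quad_hat hx a⟩⟩, fun hx hn => ?_⟩
  · exact Function.LeftInverse.injective fun y => h.quad_hat_quad x y hx
  · obtain ⟨e, he⟩ := h.units.exists_notMem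
    obtain ⟨y, rfl⟩ := hx.2 e
    exact he (h.quad_mem hn y)

theorem idealConditions (h : JordanUnits N N' hat hat' S S') :
    IdealConditions (LinearMap.BilinMap.toQuadraticMap S) (LinearMap.BilinMap.toQuadraticMap S')
      N N' := by
  intro x hx y z
  refine ⟨h.swap.quad_mem_right y hx, h.quad_mem hx y, ?_⟩
  rw [triple_toQuadraticMap h.symm]
  exact nsmul_mem (h.apply_mem hx z y) 2

theorem isLocal (h : JordanUnits N N' hat hat' S S') :
    IsLocal (LinearMap.BilinMap.toQuadraticMap S) (LinearMap.BilinMap.toQuadraticMap S') := by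
  refine ⟨N, N', fun x => (h.not_isInvertible_iff x).symm,
    fun y => (h.swap.not_isInvertible_iff y).symm, ⟨h.idealConditions, h.swap.idealConditions⟩, ?_⟩
  rintro ⟨rfl, -⟩
  obtain ⟨e, he⟩ := h.units.exists_notMem
  exact he Submodule.mem_top

end JordanUnits

end Bergman

/-! ## From `μ`-maps to Jordan pairs -/

section MuUnits

variable {k A C : Type*} [CommRing k] [AddCommGroup A] [AddCommGroup C] [Module k A] [Module k C]

/-- `½ T`, which turns the biadditive `μ_{x,z}` into a quadratic map `Q_x = ½ μ_{x,x}`; the halves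
are taken in the target. -/
noncomputable def halfPolar (T : A →ₗ[k] A →ₗ[k] C →ₗ[k] A)
    (h2 : Function.Bijective fun a : A => 2 • a) : A →ₗ[k] A →ₗ[k] C →ₗ[k] A :=
  T.compr₂ (LinearMap.compRight k
    (LinearEquiv.ofBijective ((2 : ℕ) • LinearMap.id : A →ₗ[k] A) h2).symm.toLinearMap)

theorem two_halfPolar (T : A →ₗ[k] A →ₗ[k] C →ₗ[k] A)
    (h2 : Function.Bijective fun a : A => 2 • a) (x z : A) (y : C) :
    2 • halfPolar T h2 x z y = T x z y :=
  (LinearEquiv.ofBijective ((2 : ℕ) • LinearMap.id : A →ₗ[k] A) h2).apply_symm_apply (T x z y)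

/-- One sign of `MuUnits`. The elements outside `N` are the units, `hat x` is the unit `x` viewed in
the opposite group, `P x` is `μ_x : V^{-σ} → V^σ`, and `T` is the biadditive extension of
`μ_{x+z} - μ_x - μ_z`. -/
structure HalfMuUnits (N : Submodule k A) (N' : Submodule k C) (hat : A → C) (hat' : C → A)
    (P : A → C →+ A) (P' : C → A →+ C) (T : A →ₗ[k] A →ₗ[k] C →ₗ[k] A) : Prop where
  units : UnitComplement N
  hat_notMem : ∀ x, x ∉ N → hat x ∉ N'
  hat_hat : ∀ x, x ∉ N → hat' (hat x) = x
  hat_neg : ∀ x, x ∉ N → hat (-x) = -hat x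
  mu_hat_mu : ∀ x y, x ∉ N → P' (hat x) (P x y) = y
  mu_hat : ∀ x, x ∉ N → P x (hat x) = -x
  mu_notMem : ∀ x y, x ∉ N → y ∉ N' → P x y ∉ N
  polar : ∀ x z y, x ∉ N → z ∉ N → x + z ∉ N → T x z y = P (x + z) y - P x y - P z y
  mu_add_hat : ∀ x b, x ∉ N → b ∉ N → x + b ∉ N → P (x + b) (hat x) = P b (hat x) - 2 • b - x
  hat_add_hat_notMem : ∀ a b, a ∉ N → b ∉ N → a + b ∉ N → hat a + hat b ∉ N'
  mu_hat_add_hat : ∀ a b z, a ∉ N → b ∉ N → a + b ∉ N →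
    P' (hat a + hat b) z = P' (hat b) (P (a + b) (P' (hat a) z))
  mu_mu : ∀ x y z, x ∉ N → y ∉ N' → P (P x y) z = P x (P' y (P (-x) z))
  mu_add_sub_mem : ∀ x n y, x ∉ N → n ∈ N → P (x + n) y - P x y ∈ N

/-- The properties of the `μ`-maps of a special local Moufang set with abelian root groups whose
polarizations `μ_{x+z} - μ_x - μ_z` extend biadditively. -/
structure MuUnits (N : Submodule k A) (N' : Submodule k C) (hat : A → C) (hat' : C → A)
    (P : A → C →+ A) (P' : C → A →+ C) (T : A →ₗ[k] A →ₗ[k] C →ₗ[k] A)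
    (T' : C →ₗ[k] C →ₗ[k] A →ₗ[k] C) : Prop extends HalfMuUnits N N' hat hat' P P' T where
  minus : HalfMuUnits N' N hat' hat P' P T'

namespace MuUnits

variable {N : Submodule k A} {N' : Submodule k C} {hat : A → C} {hat' : C → A}
  {P : A → C →+ A} {P' : C → A →+ C} {T : A →ₗ[k] A →ₗ[k] C →ₗ[k] A}
  {T' : C →ₗ[k] C →ₗ[k] A →ₗ[k] C}

theorem swap (h : MuUnits N N' hat hat' P P' T T') : MuUnits N' N hat' hat P' P T' T :=
  { h.minus with minus := h.toHalfMuUnits }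

theorem mu_mu_hat (h : MuUnits N N' hat hat' P P' T T') {x : A} (hx : x ∉ N) (z : A) :
    P x (P' (hat x) z) = z := by
  simpa only [h.hat_hat x hx] using h.swap.mu_hat_mu (hat x) z (h.hat_notMem x hx)

theorem polar_self (h : MuUnits N N' hat hat' P P' T T') {x : A} (hx : x ∉ N) (y : C) :
    T x x y = P x y + P (-x) y := by
  have h2x := h.units.two_nsmul x hx
  have polar_add := h.polar x x y hx hx (by rwa [← two_nsmul])
  have polar_sub := h.polar (2 • x) (-x) y h2x (neg_notMem hx)
    (by rwa [two_nsmul, add_neg_cancel_right])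
  simp only [two_nsmul, add_neg_cancel_right, map_add, map_neg, LinearMap.add_apply,
    LinearMap.neg_apply] at polar_sub
  linear_combination (norm := module) -polar_add - polar_sub

theorem mu_two_nsmul (h : MuUnits N N' hat hat' P P' T T') {x : A} (hx : x ∉ N) (y : C) :
    P (2 • x) y = 3 • P x y + P (-x) y := by
  have polar := h.polar x x y hx hx (by simpa only [two_nsmul] using h.units.two_nsmul x hx)
  rw [h.polar_self hx, ← two_nsmul] at polar
  linear_combination (norm := module) -polar

theorem mu_three_nsmul (h : MuUnits N N' hat hat' P P' T T') {x : A} (hx : x ∉ N) (y : C) :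
    P (3 • x) y = 6 • P x y + 3 • P (-x) y := by
  have polar := h.polar (2 • x) x y (h.units.two_nsmul x hx) hx
    (by simpa only [← succ_nsmul] using h.units.three_nsmul x hx)
  rw [← succ_nsmul, map_nsmul, LinearMap.smul_apply, LinearMap.smul_apply, h.polar_self hx,
    h.mu_two_nsmul hx] at polar
  linear_combination (norm := module) -polar

theorem mu_four_nsmul (h : MuUnits N N' hat hat' P P' T T') {x : A} (hx : x ∉ N) (y : C) :
    P (4 • x) y = 10 • P x y + 6 • P (-x) y := by
  rw [show 4 • x = 2 • 2 • x by module, h.mu_two_nsmul (h.units.two_nsmul x hx),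
    h.mu_two_nsmul hx, ← smul_neg, h.mu_two_nsmul (neg_notMem hx), neg_neg]
  module

/-- If `μ_w` is divisible by `n`, then every element is, because `μ_w` is invertible. -/
theorem nsmul_bijective (h : MuUnits N N' hat hat' P P' T T') {x w : A} (hx : x ∉ N) (hw : w ∉ N)
    {n i j : ℕ} (mu_eq : ∀ y, P w y = (n * i) • P x y + (n * j) • P (-x) y) :
    Function.Bijective fun a : A => n • a := by
  constructor
  · refine (injective_iff_map_eq_zero (nsmulAddMonoidHom n : A →+ A)).2 fun a ha => ?_
    change n • a = 0 at ha
    have hy : n • P' (hat x) a = 0 := by rw [← map_nsmul, ha, map_zero]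
    have mu_w := mu_eq (P' (hat x) a)
    rw [mul_comm n i, mul_smul, ← map_nsmul (P x), mul_comm n j, mul_smul, ← map_nsmul (P (-x)),
      hy, map_zero, map_zero, smul_zero, smul_zero, add_zero] at mu_w
    rw [← h.mu_mu_hat hx a, ← h.mu_hat_mu w (P' (hat x) a) hw, mu_w, map_zero, map_zero]
  · refine fun a => ⟨i • P x (P' (hat w) a) + j • P (-x) (P' (hat w) a), ?_⟩
    beta_reduce
    rw [smul_add, ← mul_smul, ← mul_smul, ← mu_eq, h.mu_mu_hat hw]

theorem two_bijective (h : MuUnits N N' hat hat' P P' T T') :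
    Function.Bijective fun a : A => 2 • a := by
  obtain ⟨x, hx⟩ := h.units.exists_notMem
  have h4x : 4 • x ∉ N := by
    rw [show 4 • x = 2 • 2 • x by module]
    exact h.units.two_nsmul _ (h.units.two_nsmul x hx)
  exact h.nsmul_bijective (i := 5) (j := 3) hx h4x (h.mu_four_nsmul hx)

theorem three_bijective (h : MuUnits N N' hat hat' P P' T T') :
    Function.Bijective fun a : A => 3 • a := by
  obtain ⟨x, hx⟩ := h.units.exists_notMem
  exact h.nsmul_bijective (i := 2) (j := 1) hx (h.units.three_nsmul x hx) (h.mu_three_nsmul hx)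

theorem two_regular (h : MuUnits N N' hat hat' P P' T T') : IsSMulRegular A 2 :=
  h.two_bijective.1

theorem polar_symm (h : MuUnits N N' hat hat' P P' T T') (x z : A) : T x z = T z x := by
  ext y
  refine sub_eq_zero.1 (h.units.biadditive_eq_zero_of_notMem h.two_regular
    (biadditive (fun x z => T x z y - T z x y) ?_ ?_) (fun x z hx hz hxz => ?_) x z)
  · intros; simp only [map_add, LinearMap.add_apply]; abel
  · intros; simp only [map_add, LinearMap.add_apply]; abel
  · rw [biadditive_apply, h.polar x z y hx hz hxz, h.polar z x y hz hx (by rwa [add_comm]),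
      add_comm z x]
    abel

theorem polar_hat (h : MuUnits N N' hat hat' P P' T T') {x : A} (hx : x ∉ N) (z : A) :
    T x z (hat x) = -(2 • z) := by
  refine eq_neg_of_add_eq_zero_left (h.units.eq_zero_of_inGeneralPosition h.two_regular
    (AddMonoidHom.mk' (fun z => T x z (hat x) + 2 • z) ?_) hx (fun z ⟨hz, hadd, _⟩ => ?_) z)
  · intros; simp only [map_add, LinearMap.add_apply]; module
  · rw [AddMonoidHom.mk'_apply, h.polar x z _ hx hz hadd, h.mu_add_hat x z hx hz hadd,
      h.mu_hat x hx]
    abel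

theorem polar_hat_hat (h : MuUnits N N' hat hat' P P' T T') {a b : A} (ha : a ∉ N) (hb : b ∉ N)
    (hab : a + b ∉ N) (y : C) : T' (hat a) (hat b) (P a y) = P' (hat b) (T a b y) := by
  rw [h.swap.polar _ _ _ (h.hat_notMem a ha) (h.hat_notMem b hb)
    (h.hat_add_hat_notMem a b ha hb hab),
    h.mu_hat_add_hat a b _ ha hb hab, h.polar a b y ha hb hab, map_sub, map_sub, h.mu_hat_mu a y ha,
    h.mu_hat_mu b y hb]
  abel

/-- Comparing `polar_hat_hat` at `(a, b)` and `(a, -b)` shows that `μ_b⁻¹` and `μ_{-b}⁻¹` agree. -/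
theorem mu_neg_hat (h : MuUnits N N' hat hat' P P' T T') {b : A} (hb : b ∉ N) (a : A) :
    P' (hat b) a = P' (-hat b) a := by
  refine sub_eq_zero.1 (h.units.eq_zero_of_inGeneralPosition h.swap.two_regular
    (P' (hat b) - P' (-hat b)) hb (fun a ⟨ha, hadd, hsub⟩ => ?_) a)
  have pos := h.polar_hat_hat ha hb (by rwa [add_comm]) (hat b)
  have neg := h.polar_hat_hat ha (neg_notMem hb)
    (by rw [← neg_mem_iff]; rwa [neg_add, neg_neg, neg_add_eq_sub]) (-hat b)
  rw [h.hat_neg b hb] at neg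
  simp only [map_neg, LinearMap.neg_apply, neg_neg, h.polar_symm a b, h.polar_hat hb, map_nsmul]
    at pos neg
  refine h.swap.two_regular.right_eq_zero_of_smul ?_
  linear_combination (norm := (simp only [AddMonoidHom.sub_apply]; module)) pos - neg

theorem mu_neg (h : MuUnits N N' hat hat' P P' T T') {b : A} (hb : b ∉ N) : P (-b) = P b := by
  ext y
  have key := h.mu_neg_hat hb (P b y)
  rw [h.mu_hat_mu b y hb, ← h.hat_neg b hb] at key
  rw [key, h.mu_mu_hat (neg_notMem hb), ← key]

theorem halfPolar_self (h : MuUnits N N' hat hat' P P' T T') {x : A} (hx : x ∉ N) (y : C) :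
    halfPolar T h.two_bijective x x y = P x y := by
  apply h.two_regular
  beta_reduce
  rw [two_halfPolar, h.polar_self hx, h.mu_neg hx, two_nsmul]

theorem halfJordanUnits (h : MuUnits N N' hat hat' P P' T T') :
    HalfJordanUnits N N' hat hat' (halfPolar T h.two_bijective)
      (halfPolar T' h.swap.two_bijective) where
  units := h.units
  two_regular := h.two_regular
  three_regular := h.three_bijective.1
  hat_notMem := h.hat_notMem
  hat_hat := h.hat_hat
  hat_neg := h.hat_neg
  symm x z := by
    ext y
    apply h.two_regular
    simp only [two_halfPolar, h.polar_symm x z]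
  apply_hat x z hx := by
    apply h.two_regular
    simp only [two_halfPolar, h.polar_hat hx, smul_neg]
  quad_hat_quad x y hx := by
    rw [h.halfPolar_self hx, h.swap.halfPolar_self (h.hat_notMem x hx), h.mu_hat_mu x y hx]
  fundamental x y z hx hy := by
    simp only [h.halfPolar_self hx, h.halfPolar_self (h.mu_notMem x y hx hy),
      h.swap.halfPolar_self hy, h.mu_mu x y z hx hy, h.mu_neg hx]
  quad_notMem x y hx hy := by
    rw [h.halfPolar_self hx]
    exact h.mu_notMem x y hx hy
  polar_hat_quad_of_add a b y ha hb hab := by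
    apply h.swap.two_regular
    beta_reduce
    rw [two_halfPolar, h.halfPolar_self ha, ← map_nsmul, two_halfPolar,
      h.swap.halfPolar_self (h.hat_notMem b hb), h.polar_hat_hat ha hb hab]
  quad_add_sub_mem x n y hx hn := by
    rw [h.halfPolar_self hx, h.halfPolar_self (add_notMem_of_mem hx hn)]
    exact h.mu_add_sub_mem x n y hx hn

theorem jordanUnits (h : MuUnits N N' hat hat' P P' T T') :
    JordanUnits N N' hat hat' (halfPolar T h.two_bijective)
      (halfPolar T' h.swap.two_bijective) where
  toHalfJordanUnits := h.halfJordanUnits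
  minus := h.swap.halfJordanUnits

end MuUnits

end MuUnits

/-! ## The `μ`-maps of a special local Moufang set -/

namespace LocalMoufangSet

variable {X : Type u} {M : LocalMoufangSet X}

theorem conj_mem {g u : SymRel M.rel} {x y : X} (hg : g ∈ (⨆ y, M.U y : Subgroup (SymRel M.rel)))
    (hu : u ∈ M.U x) (hxy : g • x = y) : g * u * g⁻¹ ∈ M.U y := by
  rw [← hxy, ← M.conj_eq x g hg]
  exact ⟨u, hu, rfl⟩

namespace Basis

theorem IsUnit.swap {B : M.Basis} {x : X} (hx : B.IsUnit x) : B.swap.IsUnit x := ⟨hx.2, hx.1⟩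

theorem IsUnit.of_swap {B : M.Basis} {x : X} (hx : B.swap.IsUnit x) : B.IsUnit x := ⟨hx.2, hx.1⟩

section

variable (B : M.Basis) {x z : X}

theorem eq_of_smul_zero_eq {g h : SymRel M.rel} (hg : g ∈ M.U B.inf) (hh : h ∈ M.U B.inf)
    (e : g • B.zero = h • B.zero) : g = h :=
  (M.sharplyTransitive B.inf B.zero _ B.not_rel (B.smul_not_rel h hh _ B.not_rel)).unique
    ⟨hg, e⟩ ⟨hh, rfl⟩

/-- The element `β_x` of `U_0` that maps `∞` to the unit `x`. -/
noncomputable abbrev betaUnit (x : X) (hx : B.IsUnit x) : SymRel M.rel :=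
  B.swap.alphaUnit x hx.swap

theorem alphaUnit_mem (hx : B.IsUnit x) : B.alphaUnit x hx ∈ M.U B.inf := B.alpha_mem _

theorem alphaUnit_zero (hx : B.IsUnit x) : B.alphaUnit x hx • B.zero = x := B.alpha_smul _

theorem alphaUnit_inf (hx : B.IsUnit x) : B.alphaUnit x hx • B.inf = B.inf :=
  M.fixes _ _ (B.alphaUnit_mem hx)

theorem betaUnit_mem (hx : B.IsUnit x) : B.betaUnit x hx ∈ M.U B.zero :=
  B.swap.alphaUnit_mem hx.swap

theorem betaUnit_inf (hx : B.IsUnit x) : B.betaUnit x hx • B.inf = x :=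
  B.swap.alphaUnit_zero hx.swap

theorem eq_alphaUnit (hx : B.IsUnit x) {g : SymRel M.rel} (hg : g ∈ M.U B.inf)
    (e : g • B.zero = x) : g = B.alphaUnit x hx :=
  B.alpha_unique _ g hg e

theorem eq_betaUnit (hx : B.IsUnit x) {g : SymRel M.rel} (hg : g ∈ M.U B.zero)
    (e : g • B.inf = x) : g = B.betaUnit x hx :=
  B.swap.eq_alphaUnit hx.swap hg e

theorem mu_mem (hx : B.IsUnit x) : B.mu x hx ∈ (⨆ y, M.U y : Subgroup (SymRel M.rel)) := by
  obtain ⟨g, hg, h, hh, e⟩ := (B.existsUnique_mu x hx).choose_spec.1.1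
  change B.mu x hx = _ at e
  rw [e]
  exact mul_mem (mul_mem (Subgroup.mem_iSup_of_mem _ hh)
    (Subgroup.mem_iSup_of_mem _ (B.alphaUnit_mem hx))) (Subgroup.mem_iSup_of_mem _ hg)

theorem eq_mu (hx : B.IsUnit x) {m g h : SymRel M.rel} (hg : g ∈ M.U B.zero) (hh : h ∈ M.U B.zero)
    (e : m = h * B.alphaUnit x hx * g) (h0 : m • B.zero = B.inf) (hi : m • B.inf = B.zero) :
    m = B.mu x hx :=
  (B.existsUnique_mu x hx).choose_spec.2 m ⟨⟨g, hg, h, hh, e⟩, h0, hi⟩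

theorem mu_inv_zero (hx : B.IsUnit x) : (B.mu x hx)⁻¹ • B.zero = B.inf := by
  rw [inv_smul_eq_iff, B.mu_inf]

theorem mu_inv_inf (hx : B.IsUnit x) : (B.mu x hx)⁻¹ • B.inf = B.zero := by
  rw [inv_smul_eq_iff, B.mu_zero]

theorem mu_conj_alphaUnit (hx : B.IsUnit x) (hz : B.IsUnit z) {p : X} (hp : B.IsUnit p)
    (e : p = B.mu x hx • z) : B.mu x hx * B.alphaUnit z hz * (B.mu x hx)⁻¹ = B.betaUnit p hp := by
  refine B.eq_betaUnit hp (conj_mem (B.mu_mem hx) (B.alphaUnit_mem hz) (B.mu_inf x hx)) ?_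
  rw [mul_smul, mul_smul, B.mu_inv_inf, B.alphaUnit_zero, e]

theorem mu_conj_betaUnit (hx : B.IsUnit x) (hz : B.IsUnit z) {p : X} (hp : B.IsUnit p)
    (e : p = B.mu x hx • z) : B.mu x hx * B.betaUnit z hz * (B.mu x hx)⁻¹ = B.alphaUnit p hp := by
  refine B.eq_alphaUnit hp (conj_mem (B.mu_mem hx) (B.betaUnit_mem hz) (B.mu_zero x hx)) ?_
  rw [mul_smul, mul_smul, B.mu_inv_zero, B.betaUnit_inf, e]

theorem alpha_muPlus (hx : B.IsUnit x) (y : B.swap.Aff) :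
    B.alpha (B.muPlus x hx y) = B.mu x hx * B.swap.alpha y * (B.mu x hx)⁻¹ := by
  refine B.eq_of_smul_zero_eq (B.alpha_mem _)
    (conj_mem (B.mu_mem hx) (B.swap.alpha_mem y) (B.mu_zero x hx)) ?_
  rw [B.alpha_smul, mul_smul, mul_smul, B.mu_inv_zero]
  exact congrArg _ (B.swap.alpha_smul y).symm

theorem induced_alphaUnit_eq (hx : B.IsUnit x) (hz : B.IsUnit z) (hxz : M.rel x z) :
    SymRel.induced M.rel (B.alphaUnit x hx) = SymRel.induced M.rel (B.alphaUnit z hz) := by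
  have zero_ne : Quotient.mk M.rel B.zero ≠ Quotient.mk M.rel B.inf :=
    fun e => B.not_rel (Quotient.exact e)
  have ne : Quotient.mk M.rel z ≠ Quotient.mk M.rel B.inf := fun e => hz.2 (Quotient.exact e)
  refine (M.induced_sharplyTransitive B.inf _ _ zero_ne ne).unique
    ⟨⟨_, B.alphaUnit_mem hx, rfl⟩, Quotient.sound ?_⟩
    ⟨⟨_, B.alphaUnit_mem hz, rfl⟩, congrArg _ (B.alphaUnit_zero hz)⟩
  change M.rel (B.alphaUnit x hx • B.zero) z
  rwa [B.alphaUnit_zero]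

end

/-- The negatives of a unit in `V⁺` and in `V⁻` agree; this is the form in which the condition that
`M` is special is used, and it is symmetric in `0` and `∞`. -/
def NegSwap (B : M.Basis) : Prop :=
  ∀ (x : X) (hx : B.IsUnit x), (B.betaUnit x hx)⁻¹ • B.inf = (B.alphaUnit x hx)⁻¹ • B.zero

theorem IsSpecial.negSwap {B : M.Basis} {e : X} {he : B.IsUnit e} (h : B.IsSpecial e he) :
    B.NegSwap := by
  intro x hx
  let y : B.Aff := B.muInvPlus e he ⟨x, hx.1⟩
  have conj_eq : B.mu e he * B.alpha y * (B.mu e he)⁻¹ = B.betaUnit x hx := by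
    refine B.eq_betaUnit hx (conj_mem (B.mu_mem he) (B.alpha_mem y) (B.mu_inf e he)) ?_
    rw [mul_smul, mul_smul, B.mu_inv_inf, B.alpha_smul]
    exact smul_inv_smul _ _
  have special : B.mu e he • (B.alpha y)⁻¹ • B.zero = (B.alphaUnit x hx)⁻¹ • B.zero := h x hx
  rw [← conj_eq, ← special, mul_inv_rev, mul_inv_rev, inv_inv, mul_smul, mul_smul, B.mu_inv_inf]

namespace NegSwap

variable {B : M.Basis} {x z p : X}

theorem swap (h : B.NegSwap) : B.swap.NegSwap := fun x hx => (h x hx.swap).symm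

theorem mu_eq (h : B.NegSwap) (hx : B.IsUnit x) :
    B.mu x hx = (B.betaUnit x hx)⁻¹ * B.alphaUnit x hx * (B.betaUnit x hx)⁻¹ := by
  have hb := inv_mem (B.betaUnit_mem hx)
  refine (B.eq_mu hx hb hb rfl ?_ ?_).symm
  · rw [mul_smul, mul_smul, M.fixes _ _ hb, B.alphaUnit_zero, inv_smul_eq_iff, B.betaUnit_inf]
  · rw [mul_smul, mul_smul, h x hx, smul_inv_smul, M.fixes _ _ hb]

theorem mu_smul_self (h : B.NegSwap) (hx : B.IsUnit x) :
    B.mu x hx • x = (B.alphaUnit x hx)⁻¹ • B.zero := by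
  have beta_inv : (B.betaUnit x hx)⁻¹ • x = B.inf := by rw [inv_smul_eq_iff, B.betaUnit_inf]
  rw [h.mu_eq, mul_smul, mul_smul, beta_inv, B.alphaUnit_inf, h x hx]

theorem mu_conj_betaUnit_self (h : B.NegSwap) (hx : B.IsUnit x) :
    B.mu x hx * B.betaUnit x hx * (B.mu x hx)⁻¹ = (B.alphaUnit x hx)⁻¹ := by
  refine B.eq_of_smul_zero_eq (conj_mem (B.mu_mem hx) (B.betaUnit_mem hx) (B.mu_zero x hx))
    (inv_mem (B.alphaUnit_mem hx)) ?_
  rw [mul_smul, mul_smul, B.mu_inv_zero, B.betaUnit_inf, h.mu_smul_self]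

theorem alphaUnit_eq (h : B.NegSwap) (hx : B.IsUnit x) :
    B.alphaUnit x hx = B.betaUnit x hx * B.mu x hx * B.betaUnit x hx := by
  rw [h.mu_eq]
  group

theorem betaUnit_eq (h : B.NegSwap) (hx : B.IsUnit x) :
    B.betaUnit x hx = B.alphaUnit x hx * (B.mu x hx)⁻¹ * B.alphaUnit x hx := by
  have conj := h.mu_conj_betaUnit_self hx
  rw [mul_inv_eq_iff_eq_mul] at conj
  calc B.betaUnit x hx
      = B.betaUnit x hx * ((B.alphaUnit x hx)⁻¹ * B.mu x hx) * (B.mu x hx)⁻¹ * B.alphaUnit x hx :=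
        by group
    _ = B.alphaUnit x hx * (B.mu x hx)⁻¹ * B.alphaUnit x hx := by
        rw [← conj, ← mul_assoc, ← h.alphaUnit_eq]

theorem mu_eq_alphaUnit (h : B.NegSwap) (hx : B.IsUnit x) :
    B.mu x hx = B.alphaUnit x hx * (B.betaUnit x hx)⁻¹ * B.alphaUnit x hx := by
  rw [h.betaUnit_eq]
  group

theorem mu_swap (h : B.NegSwap) (hx : B.IsUnit x) : B.swap.mu x hx.swap = (B.mu x hx)⁻¹ := by
  have swap_mu_eq : B.swap.mu x hx.swap
      = (B.alphaUnit x hx)⁻¹ * B.betaUnit x hx * (B.alphaUnit x hx)⁻¹ := h.swap.mu_eq hx.swap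
  rw [swap_mu_eq, h.mu_eq_alphaUnit]
  group

theorem mu_neg (h : B.NegSwap) (hx : B.IsUnit x) (hp : B.IsUnit p)
    (e : p = (B.alphaUnit x hx)⁻¹ • B.zero) : B.mu p hp = (B.mu x hx)⁻¹ := by
  rw [h.mu_eq hp, ← B.eq_alphaUnit hp (inv_mem (B.alphaUnit_mem hx)) e.symm,
    ← B.eq_betaUnit hp (inv_mem (B.betaUnit_mem hx)) ((h x hx).trans e.symm), h.mu_eq hx]
  group

theorem mu_mu_smul (h : B.NegSwap) (hx : B.IsUnit x) (hz : B.IsUnit z) (hp : B.IsUnit p)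
    (e : p = B.mu x hx • z) : B.mu p hp = B.mu x hx * (B.mu z hz)⁻¹ * (B.mu x hx)⁻¹ := by
  rw [h.mu_eq_alphaUnit hp, ← B.mu_conj_alphaUnit hx hz hp e, ← B.mu_conj_betaUnit hx hz hp e,
    h.mu_eq hz]
  group

/-- The product `β_z β_x` is `μ_z⁻¹ μ_{x+z} μ_x⁻¹` up to factors in `U_∞` on both sides. -/
theorem mu_swap_add (h : B.NegSwap) (hx : B.IsUnit x) (hz : B.IsUnit z) {s t : X}
    (hs : B.IsUnit s) (ht : B.IsUnit t) (es : B.alphaUnit z hz • x = s)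
    (et : B.betaUnit z hz • x = t) :
    (B.mu t ht)⁻¹ = (B.mu z hz)⁻¹ * B.mu s hs * (B.mu x hx)⁻¹ := by
  have alpha_mul : B.alphaUnit z hz * B.alphaUnit x hx = B.alphaUnit s hs :=
    B.eq_alphaUnit hs (mul_mem (B.alphaUnit_mem hz) (B.alphaUnit_mem hx))
      (by rw [mul_smul, B.alphaUnit_zero, es])
  have beta_mul : B.betaUnit z hz * B.betaUnit x hx = B.betaUnit t ht :=
    B.eq_betaUnit ht (mul_mem (B.betaUnit_mem hz) (B.betaUnit_mem hx))
      (by rw [mul_smul, B.betaUnit_inf, et])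
  have left_mem : B.alphaUnit z hz * ((B.mu z hz)⁻¹ * B.betaUnit s hs * (B.mu z hz)⁻¹⁻¹)
      ∈ M.U B.inf :=
    mul_mem (B.alphaUnit_mem hz)
      (conj_mem (inv_mem (B.mu_mem hz)) (B.betaUnit_mem hs) (B.mu_inv_zero hz))
  have right_mem : B.mu x hx * B.betaUnit s hs * (B.mu x hx)⁻¹ * B.alphaUnit x hx ∈ M.U B.inf :=
    mul_mem (conj_mem (B.mu_mem hx) (B.betaUnit_mem hs) (B.mu_zero x hx)) (B.alphaUnit_mem hx)
  rw [← h.mu_swap ht]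
  refine (B.swap.eq_mu ht.swap (inv_mem right_mem) (inv_mem left_mem) ?_ ?_ ?_).symm
  · change _ = _ * B.betaUnit t ht * _
    have beta_eq : B.betaUnit t ht = B.alphaUnit z hz * (B.mu z hz)⁻¹ * B.alphaUnit s hs
        * (B.mu x hx)⁻¹ * B.alphaUnit x hx := by
      rw [← beta_mul, ← alpha_mul, h.betaUnit_eq hx, h.betaUnit_eq hz]
      group
    rw [beta_eq, h.alphaUnit_eq hs]
    group
  · change _ • B.inf = B.zero
    rw [mul_smul, mul_smul, B.mu_inv_inf, B.mu_zero, B.mu_inv_inf]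
  · change _ • B.zero = B.inf
    rw [mul_smul, mul_smul, B.mu_inv_zero, B.mu_inf, B.mu_inv_zero]

theorem mu_smul_rel (h : B.NegSwap) (hx : B.IsUnit x) (hz : B.IsUnit z) (hxz : M.rel x z)
    (y : X) : M.rel (B.mu x hx • y) (B.mu z hz • y) := by
  have induced_eq : SymRel.induced M.rel (B.mu x hx) = SymRel.induced M.rel (B.mu z hz) := by
    simp only [h.mu_eq, map_mul, map_inv, B.induced_alphaUnit_eq hx hz hxz, betaUnit,
      B.swap.induced_alphaUnit_eq hx.swap hz.swap hxz]
  exact Quotient.exact (DFunLike.congr_fun induced_eq (Quotient.mk M.rel y))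

end NegSwap

variable {B : M.Basis} {hB : B.IsAbelian}

namespace V

/-- The element `α_x` for `x` in `V⁺`. -/
noncomputable def alpha (x : B.V hB) : SymRel M.rel := Basis.alpha B x

theorem ext {x z : B.V hB} (h : x.pt = z.pt) : x = z := Subtype.ext h

theorem not_rel_inf (x : B.V hB) : ¬ M.rel x.pt B.inf := Subtype.property x

theorem alpha_mem (x : B.V hB) : x.alpha ∈ M.U B.inf := Basis.alpha_mem B x

theorem alpha_injective {x z : B.V hB} (h : x.alpha = z.alpha) : x = z :=
  Basis.alpha_injective B h

theorem alpha_smul_zero (x : B.V hB) : x.alpha • B.zero = x.pt := Basis.alpha_smul B x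

theorem alpha_zero : (0 : B.V hB).alpha = 1 := Basis.alpha_orbitPt B _ (one_mem _)

theorem alpha_add (x z : B.V hB) : (x + z).alpha = z.alpha * x.alpha :=
  Basis.alpha_orbitPt B _ (mul_mem z.alpha_mem x.alpha_mem)

theorem alpha_neg (x : B.V hB) : (-x).alpha = x.alpha⁻¹ :=
  Basis.alpha_orbitPt B _ (inv_mem x.alpha_mem)

theorem alpha_nsmul (n : ℕ) (x : B.V hB) : (n • x).alpha = x.alpha ^ n := by
  induction n with
  | zero => rw [zero_smul, alpha_zero, pow_zero]
  | succ n ih => rw [succ_nsmul, alpha_add, ih, pow_succ']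

theorem pt_zero : (0 : B.V hB).pt = B.zero := one_smul _ _

theorem pt_add (x z : B.V hB) : (x + z).pt = z.alpha • x.pt := by
  rw [← alpha_smul_zero, alpha_add, mul_smul, alpha_smul_zero]

theorem pt_neg (x : B.V hB) : (-x).pt = x.alpha⁻¹ • B.zero := by
  rw [← alpha_smul_zero, alpha_neg]

theorem pt_sub (x z : B.V hB) : (x - z).pt = z.alpha⁻¹ • x.pt := by
  rw [sub_eq_add_neg, pt_add, alpha_neg]

theorem pt_nsmul (n : ℕ) (x : B.V hB) : (n • x).pt = x.alpha ^ n • B.zero := by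
  rw [← alpha_smul_zero, alpha_nsmul]

end V

theorem NegSwap.pt_neg_eq (h : B.NegSwap) {y : B.swap.V hB.swap} {x : B.V hB} (e : y.pt = x.pt) :
    (-y).pt = (-x).pt := by
  have hx : B.IsUnit x.pt := ⟨e ▸ y.not_rel_inf, x.not_rel_inf⟩
  rw [V.pt_neg, V.pt_neg, B.eq_betaUnit hx y.alpha_mem (y.alpha_smul_zero.trans e)]
  exact h x.pt hx

variable (B hB) in
/-- The submodule `[0]` of `V⁺`. -/
noncomputable def nonunits : Submodule ℤ (B.V hB) := AddSubgroup.toIntSubmodule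
  { carrier := {x | M.rel x.pt B.zero}
    zero_mem' := by
      change M.rel (0 : B.V hB).pt B.zero
      rw [V.pt_zero]
    add_mem' := by
      intro x z hx hz
      change M.rel (x + z).pt B.zero
      rw [V.pt_add]
      refine M.rel.trans ((SymRel.rel_smul z.alpha _ _).2 hx) ?_
      rw [V.alpha_smul_zero]
      exact hz
    neg_mem' := by
      intro x hx
      change M.rel (-x).pt B.zero
      rw [V.pt_neg, ← SymRel.rel_smul x.alpha, smul_inv_smul, V.alpha_smul_zero]
      exact M.rel.symm hx }

theorem mem_nonunits {x : B.V hB} : x ∈ B.nonunits hB ↔ M.rel x.pt B.zero := Iff.rfl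

theorem sub_mem_nonunits {x z : B.V hB} : x - z ∈ B.nonunits hB ↔ M.rel x.pt z.pt := by
  rw [mem_nonunits, ← SymRel.rel_smul z.alpha, V.alpha_smul_zero, ← V.pt_add, sub_add_cancel]

theorem isUnit_pt {x : B.V hB} (hx : x ∉ B.nonunits hB) : B.IsUnit x.pt := ⟨hx, x.not_rel_inf⟩

open Classical in
variable (B hB) in
/-- A unit of `V⁺`, viewed as an element of `V⁻`. The other elements of `V⁺` have no counterpart in
`V⁻` and are sent to the junk value `0`. -/
noncomputable def hat (x : B.V hB) : B.swap.V hB.swap :=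
  if hx : x ∈ B.nonunits hB then 0 else ⟨x.pt, hx⟩

theorem pt_hat {x : B.V hB} (hx : x ∉ B.nonunits hB) : (B.hat hB x).pt = x.pt :=
  congrArg V.pt (dif_neg hx)

theorem hat_notMem {x : B.V hB} (hx : x ∉ B.nonunits hB) :
    B.hat hB x ∉ B.swap.nonunits hB.swap := by
  rw [mem_nonunits, pt_hat hx]
  exact x.not_rel_inf

theorem hat_hat {x : B.V hB} (hx : x ∉ B.nonunits hB) : B.swap.hat hB.swap (B.hat hB x) = x :=
  V.ext ((pt_hat (hat_notMem hx)).trans (pt_hat hx))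

theorem hat_neg (h : B.NegSwap) {x : B.V hB} (hx : x ∉ B.nonunits hB) :
    B.hat hB (-x) = -B.hat hB x :=
  V.ext ((pt_hat (neg_notMem hx)).trans (h.pt_neg_eq (pt_hat hx)).symm)

theorem alpha_hat {x : B.V hB} (hx : x ∉ B.nonunits hB) :
    (B.hat hB x).alpha = B.betaUnit x.pt (isUnit_pt hx) :=
  B.eq_betaUnit _ (B.hat hB x).alpha_mem ((B.hat hB x).alpha_smul_zero.trans (pt_hat hx))

theorem hat_sub_hat_mem {x z : B.V hB} (hx : x ∉ B.nonunits hB) (hz : z ∉ B.nonunits hB) :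
    B.hat hB x - B.hat hB z ∈ B.swap.nonunits hB.swap ↔ x - z ∈ B.nonunits hB := by
  rw [sub_mem_nonunits, sub_mem_nonunits, pt_hat hx, pt_hat hz]

theorem hat_add_hat_notMem (h : B.NegSwap) {a b : B.V hB} (ha : a ∉ B.nonunits hB)
    (hb : b ∉ B.nonunits hB) (hab : a + b ∉ B.nonunits hB) :
    B.hat hB a + B.hat hB b ∉ B.swap.nonunits hB.swap := by
  rwa [← sub_neg_eq_add, ← hat_neg h hb, hat_sub_hat_mem ha (neg_notMem hb), sub_neg_eq_add]

variable (hB) in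
/-- The map `μ_x : V⁻ → V⁺` for a unit `x`, as a homomorphism. -/
noncomputable def muHom (x : X) (hx : B.IsUnit x) : B.swap.V hB.swap →+ B.V hB :=
  let f : B.swap.V hB.swap → B.V hB := B.muPlus x hx
  have alpha_f (y : B.swap.V hB.swap) : (f y).alpha = B.mu x hx * y.alpha * (B.mu x hx)⁻¹ :=
    B.alpha_muPlus hx y
  AddMonoidHom.mk' f fun y z => V.alpha_injective <| by
    rw [V.alpha_add, alpha_f, alpha_f, alpha_f, V.alpha_add]
    group

open Classical in
variable (B hB) in
/-- The map `μ_x : V⁻ → V⁺` for a unit `x` of `V⁺`; for other `x` it is set to the junk value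
`0`. -/
noncomputable def muMap (x : B.V hB) : B.swap.V hB.swap →+ B.V hB :=
  if hx : x ∈ B.nonunits hB then 0 else muHom hB x.pt ⟨hx, x.not_rel_inf⟩

theorem muMap_apply {x : B.V hB} (hx : x ∉ B.nonunits hB) (y : B.swap.V hB.swap) :
    B.muMap hB x y = B.muPlus x.pt (isUnit_pt hx) y := by
  rw [muMap, dif_neg hx]
  rfl

theorem pt_muMap {x : B.V hB} (hx : x ∉ B.nonunits hB) (y : B.swap.V hB.swap) :
    (B.muMap hB x y).pt = B.mu x.pt (isUnit_pt hx) • y.pt := by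
  rw [muMap_apply hx]
  rfl

theorem pt_swap_muMap (h : B.NegSwap) {y : B.swap.V hB.swap} (hy : y ∉ B.swap.nonunits hB.swap)
    (x : B.V hB) :
    V.pt (B.swap.muMap hB.swap y x) = (B.mu y.pt (isUnit_pt hy).of_swap)⁻¹ • x.pt := by
  rw [← h.mu_swap]
  exact pt_muMap hy x

theorem pt_muMap_hat (h : B.NegSwap) {x : B.V hB} (hx : x ∉ B.nonunits hB) (z : B.V hB) :
    V.pt (B.swap.muMap hB.swap (B.hat hB x) z) = (B.mu x.pt (isUnit_pt hx))⁻¹ • z.pt := by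
  simp only [pt_swap_muMap h (hat_notMem hx), pt_hat hx]

theorem muMap_mem {x : B.V hB} (hx : x ∉ B.nonunits hB) {y : B.swap.V hB.swap} :
    B.muMap hB x y ∈ B.nonunits hB ↔ y ∈ B.swap.nonunits hB.swap := by
  rw [mem_nonunits, mem_nonunits, pt_muMap hx, ← B.mu_inf x.pt (isUnit_pt hx), SymRel.rel_smul]
  rfl

theorem muMap_hat_muMap (h : B.NegSwap) {x : B.V hB} (hx : x ∉ B.nonunits hB)
    (y : B.swap.V hB.swap) : B.swap.muMap hB.swap (B.hat hB x) (B.muMap hB x y) = y := by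
  apply V.ext
  rw [pt_muMap_hat h hx, pt_muMap hx, inv_smul_smul]

theorem muMap_hat_self (h : B.NegSwap) {x : B.V hB} (hx : x ∉ B.nonunits hB) :
    B.muMap hB x (B.hat hB x) = -x := by
  apply V.ext
  rw [pt_muMap hx, pt_hat hx, h.mu_smul_self, V.pt_neg]
  rfl

theorem pt_hat_add_sub_hat (h : B.NegSwap) {x z : B.V hB} (hx : x ∉ B.nonunits hB)
    (hz : z ∉ B.nonunits hB) (hxz : x + z ∉ B.nonunits hB) :
    (B.hat hB (x + z) - B.hat hB z).pt = (B.muMap hB z (B.hat hB x) - z).pt := by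
  rw [V.pt_sub, V.pt_sub, alpha_hat hz, pt_hat hxz, pt_muMap hz, pt_hat hx, V.pt_add,
    h.betaUnit_eq, mul_inv_rev, mul_inv_rev, inv_inv, mul_smul, mul_smul]
  exact congrArg (fun y => z.alpha⁻¹ • B.mu z.pt (isUnit_pt hz) • y) (inv_smul_smul z.alpha x.pt)

/-- Both sides of `μ_b(x) - b = μ_{x+b}(x) + (x + b)` are the difference of `x + b` and `b` in
`V⁻`. -/
theorem muMap_add_hat (h : B.NegSwap) {x b : B.V hB} (hx : x ∉ B.nonunits hB)
    (hb : b ∉ B.nonunits hB) (hxb : x + b ∉ B.nonunits hB) :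
    B.muMap hB (x + b) (B.hat hB x) = B.muMap hB b (B.hat hB x) - 2 • b - x := by
  have neg_diff := h.pt_neg_eq (pt_hat_add_sub_hat h hx hb hxb)
  have diff := pt_hat_add_sub_hat h (neg_notMem hx) hxb (by rwa [neg_add_cancel_left])
  rw [neg_add_cancel_left, hat_neg h hx, map_neg] at diff
  rw [neg_sub] at neg_diff
  have key := V.ext (diff.symm.trans neg_diff)
  linear_combination (norm := module) -key

theorem muMap_hat_add_hat (h : B.NegSwap) {a b : B.V hB} (ha : a ∉ B.nonunits hB)
    (hb : b ∉ B.nonunits hB) (hab : a + b ∉ B.nonunits hB) (z : B.V hB) :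
    B.swap.muMap hB.swap (B.hat hB a + B.hat hB b) z =
      B.swap.muMap hB.swap (B.hat hB b)
        (B.muMap hB (a + b) (B.swap.muMap hB.swap (B.hat hB a) z)) := by
  apply V.ext
  have pt_hat_add : B.betaUnit b.pt (isUnit_pt hb) • a.pt = (B.hat hB a + B.hat hB b).pt := by
    rw [V.pt_add, alpha_hat hb, pt_hat ha]
  rw [pt_swap_muMap h (hat_add_hat_notMem h ha hb hab), pt_muMap_hat h hb, pt_muMap hab,
    pt_muMap_hat h ha, h.mu_swap_add (isUnit_pt ha) (isUnit_pt hb) (isUnit_pt hab) _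
      (V.pt_add a b).symm pt_hat_add, mul_smul, mul_smul]

theorem muMap_muMap (h : B.NegSwap) {x : B.V hB} {y : B.swap.V hB.swap}
    (hx : x ∉ B.nonunits hB) (hy : y ∉ B.swap.nonunits hB.swap) (z : B.swap.V hB.swap) :
    B.muMap hB (B.muMap hB x y) z
      = B.muMap hB x (B.swap.muMap hB.swap y (B.muMap hB (-x) z)) := by
  apply V.ext
  have hxy : B.muMap hB x y ∉ B.nonunits hB := by rwa [muMap_mem hx]
  rw [pt_muMap hxy, h.mu_mu_smul (isUnit_pt hx) (isUnit_pt hy).of_swap _ (pt_muMap hx y),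
    pt_muMap hx, pt_swap_muMap h hy, pt_muMap (neg_notMem hx),
    h.mu_neg (isUnit_pt hx) (isUnit_pt (neg_notMem hx)) (V.pt_neg x), mul_smul, mul_smul]

theorem muMap_add_sub_mem (h : B.NegSwap) {x n : B.V hB} (hx : x ∉ B.nonunits hB)
    (hn : n ∈ B.nonunits hB) (y : B.swap.V hB.swap) :
    B.muMap hB (x + n) y - B.muMap hB x y ∈ B.nonunits hB := by
  rw [sub_mem_nonunits, pt_muMap hx, pt_muMap (add_notMem_of_mem hx hn)]
  refine h.mu_smul_rel _ _ ?_ _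
  rwa [← sub_mem_nonunits, add_sub_cancel_left]

theorem unitComplement (h23 : ∀ (x : X) (hx : B.IsUnit x),
    B.IsUnit (B.times ⟨x, hx.2⟩ 2).1 ∧ B.IsUnit (B.times ⟨x, hx.2⟩ 3).1) :
    UnitComplement (B.nonunits hB) where
  exists_notMem := by
    obtain ⟨c, hc⟩ := B.exists_unit
    exact ⟨⟨c, hc.2⟩, hc.1⟩
  two_nsmul x hx := by
    rw [mem_nonunits, V.pt_nsmul]
    exact (h23 x.pt (isUnit_pt hx)).1.1
  three_nsmul x hx := by
    rw [mem_nonunits, V.pt_nsmul]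
    exact (h23 x.pt (isUnit_pt hx)).2.1

theorem unitComplement_swap (h : UnitComplement (B.nonunits hB)) :
    UnitComplement (B.swap.nonunits hB.swap) := by
  obtain ⟨x, hx⟩ := h.exists_notMem
  refine ⟨⟨B.hat hB x, hat_notMem hx⟩, fun y hy => ?_, fun y hy => ?_⟩
  · rw [← muMap_mem hx, map_nsmul]
    exact h.two_nsmul _ (by rwa [muMap_mem hx])
  · rw [← muMap_mem hx, map_nsmul]
    exact h.three_nsmul _ (by rwa [muMap_mem hx])

theorem muMinus_neg (h : B.NegSwap) {y : B.swap.V hB.swap} (hy : B.swap.IsUnit y.pt)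
    (hn : B.IsUnit (-y).pt) (x : B.V hB) :
    B.muMinus (-y).pt hn x = B.swap.muPlus y.pt hy x := by
  apply Subtype.ext
  change B.mu (-y).pt hn • x.pt = B.swap.mu y.pt hy • x.pt
  rw [h.mu_swap hy.of_swap, h.mu_neg hy.of_swap hn ((V.pt_neg y).trans (h y.pt hy.of_swap))]

/-- Since `μ_{-y} = μ_y⁻¹` is the `μ`-map of `y` for the basis `(∞, 0)`, the hypotheses on the two
polarizations are exchanged by passing from `(0, ∞)` to `(∞, 0)`. -/
theorem ExtendsMuMinus.swap (h : B.NegSwap)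
    {T : B.VMinus hB →ₗ[ℤ] B.VMinus hB →ₗ[ℤ] B.VPlus hB →ₗ[ℤ] B.VMinus hB}
    (hT : B.ExtendsMuMinus hB T) : B.swap.ExtendsMuPlus hB.swap T := by
  intro y w hy hw hyw x
  have isUnit_neg {y : B.swap.V hB.swap} (hy : B.swap.IsUnit y.pt) : B.IsUnit (-y).pt :=
    (isUnit_pt (neg_notMem hy.1)).of_swap
  have hs : B.IsUnit (-y + -w).pt := neg_add y w ▸ isUnit_neg hyw
  have key := hT (-y) (-w) (isUnit_neg hy) (isUnit_neg hw) hs x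
  simp only [map_neg, LinearMap.neg_apply, neg_neg, ← neg_add] at key
  let sub (a b : B.VMinus hB) : B.VMinus hB := a - b
  exact key.trans (congrArg₂ sub (congrArg₂ sub (muMinus_neg h hyw _ x) (muMinus_neg h hy _ x))
    (muMinus_neg h hw _ x))

theorem halfMuUnits (h : B.NegSwap) (units : UnitComplement (B.nonunits hB))
    {T : B.VPlus hB →ₗ[ℤ] B.VPlus hB →ₗ[ℤ] B.VMinus hB →ₗ[ℤ] B.VPlus hB}
    (hT : B.ExtendsMuPlus hB T) :
    HalfMuUnits (B.nonunits hB) (B.swap.nonunits hB.swap) (B.hat hB) (B.swap.hat hB.swap)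
      (B.muMap hB) (B.swap.muMap hB.swap) T where
  units := units
  hat_notMem _ hx := hat_notMem hx
  hat_hat _ hx := hat_hat hx
  hat_neg _ hx := hat_neg h hx
  mu_hat_mu _ y hx := muMap_hat_muMap h hx y
  mu_hat _ hx := muMap_hat_self h hx
  mu_notMem _ _ hx hy := by rwa [muMap_mem hx]
  polar x z y hx hz hxz := by
    rw [hT x z (isUnit_pt hx) (isUnit_pt hz) (isUnit_pt hxz), muMap_apply hx, muMap_apply hz,
      muMap_apply hxz]
  mu_add_hat _ _ hx hb hxb := muMap_add_hat h hx hb hxb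
  hat_add_hat_notMem _ _ ha hb hab := hat_add_hat_notMem h ha hb hab
  mu_hat_add_hat _ _ z ha hb hab := muMap_hat_add_hat h ha hb hab z
  mu_mu _ _ z hx hy := muMap_muMap h hx hy z
  mu_add_sub_mem _ _ y hx hn := muMap_add_sub_mem h hx hn y

theorem muUnits (h : B.NegSwap) (units : UnitComplement (B.nonunits hB))
    {T : B.VPlus hB →ₗ[ℤ] B.VPlus hB →ₗ[ℤ] B.VMinus hB →ₗ[ℤ] B.VPlus hB}
    {T' : B.VMinus hB →ₗ[ℤ] B.VMinus hB →ₗ[ℤ] B.VPlus hB →ₗ[ℤ] B.VMinus hB}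
    (hT : B.ExtendsMuPlus hB T) (hT' : B.ExtendsMuMinus hB T') :
    MuUnits (B.nonunits hB) (B.swap.nonunits hB.swap) (B.hat hB) (B.swap.hat hB.swap)
      (B.muMap hB) (B.swap.muMap hB.swap) T T' where
  toHalfMuUnits := halfMuUnits h units hT
  minus := halfMuUnits h.swap (unitComplement_swap units) (ExtendsMuMinus.swap h hT')

end Basis

end LocalMoufangSet

theorem mainTheorem9 {X : Type u} (M : LocalMoufangSet X) (B : M.Basis)
    (e : X) (he : B.IsUnit e)
    (hJ1 : B.IsSpecial e he)
    (hJ2 : B.IsAbelian)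
    (hJ3 : ∀ (x : X) (hx : B.IsUnit x),
      B.IsUnit (B.times ⟨x, hx.2⟩ 2).1 ∧ B.IsUnit (B.times ⟨x, hx.2⟩ 3).1)
    (muP : B.VPlus hJ2 →ₗ[ℤ] B.VPlus hJ2 →ₗ[ℤ] B.VMinus hJ2 →ₗ[ℤ] B.VPlus hJ2)
    (muM : B.VMinus hJ2 →ₗ[ℤ] B.VMinus hJ2 →ₗ[ℤ] B.VPlus hJ2 →ₗ[ℤ] B.VMinus hJ2)
    (hJ4P : B.ExtendsMuPlus hJ2 muP) (hJ4M : B.ExtendsMuMinus hJ2 muM) :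
    UniquelyDivisible 2 (B.VPlus hJ2) ∧ UniquelyDivisible 3 (B.VPlus hJ2) ∧
    UniquelyDivisible 2 (B.VMinus hJ2) ∧
    ∃ (Qp : QuadraticMap ℤ (B.VPlus hJ2) (B.VMinus hJ2 →ₗ[ℤ] B.VPlus hJ2))
      (Qm : QuadraticMap ℤ (B.VMinus hJ2) (B.VPlus hJ2 →ₗ[ℤ] B.VMinus hJ2)),
      (∀ x y, 2 • Qp x y = muP x x y) ∧ (∀ y x, 2 • Qm y x = muM y y x) ∧
      JordanPair.IsJordanPair.{t} Qp Qm ∧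
      JordanPair.IsLocal Qp Qm ∧
      (∀ x : B.VPlus hJ2, ¬ JordanPair.IsInvertible Qp x ↔ M.rel x.pt B.zero) ∧
      (∀ y : B.VMinus hJ2, ¬ JordanPair.IsInvertible Qm y ↔ M.rel y.pt B.inf) ∧
      JordanPair.radPlus Qp Qm = {x | M.rel x.pt B.zero} ∧
      JordanPair.radMinus Qp Qm = {y | M.rel y.pt B.inf} := by
  have special := hJ1.negSwap
  have h := LocalMoufangSet.Basis.muUnits special
    (LocalMoufangSet.Basis.unitComplement hJ3) hJ4P hJ4M
  have j := h.jordanUnits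
  exact ⟨fun a => h.two_bijective.existsUnique a, fun a => h.three_bijective.existsUnique a,
    fun a => h.swap.two_bijective.existsUnique a,
    LinearMap.BilinMap.toQuadraticMap (halfPolar muP h.two_bijective),
    LinearMap.BilinMap.toQuadraticMap (halfPolar muM h.swap.two_bijective),
    fun x y => two_halfPolar _ _ x x y, fun y x => two_halfPolar _ _ y y x,
    j.fiveLinear.isJordanPair h.three_bijective h.swap.three_bijective, j.isLocal,
    j.not_isInvertible_iff, j.swap.not_isInvertible_iff,
    j.radPlus_eq, j.radMinus_eq⟩
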